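/- Let $\mathcal H\neq\{0\}$ be a (real or complex) Hilbert space and let $C$ be a bounded linear operator on $\mathcal H$ with Hermitian part $C_H=\tfrac12(C+C^*)$ and skew-Hermitian part $C_S=\tfrac12(C-C^*)$. Assume that $C$ is accretive, i.e. $C_H\ge 0$, and hypocoercive with index $m_{HC}\in\mathbb N_0$, i.e. $m_{HC}$ is the smallest $m\in\mathbb N_0$ for which there is $\kappa>0$ with $\sum_{j=0}^{m}C^jC_H(C^*)^j\ge\kappa 1_{\mathcal H}$ (in the Loewner order). Let $E\subset\mathbb R\setminus(-1,1)$ be non-empty and countable, put $C_\eta=\eta C_S+C_H$ for $\eta\in E$, let $\mathcal X=\bigoplus_{\eta\in E}\mathcal H$ be the Hilbert direct sum, and let $C_E$ be the operator on $\mathcal X$ given by $$C_E(x_\eta)_{\eta\in E}=(C_\eta x_\eta)_{\eta\in E},\qquad D(C_E)=\Big\{(x_\eta)_{\eta\in E}\in\mathcal X:\ \sum_{\eta\in E}\|C_\eta x_\eta\|^2<\infty\Big\}.$$ Then $-C_E$ is the generator of a unique strongly continuous semigroup $(T_E(t))_{t\ge0}$ on $\mathcal X$, and the following holds. (a) The operator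 $$P_E x=\Big(\sum_{j=0}^{m_{HC}}\eta^{-2j}(C_\eta^*)^jC_\eta^j x_\eta\Big)_{\eta\in E},\qquad x=(x_\eta)_{\eta\in E}\in\mathcal X,$$ is everywhere defined and bounded on $\mathcal X$, self-adjoint, and satisfies $P_E\ge 1_{\mathcal X}$. There is $\sigma>0$ such that $$\langle -C_Ex,P_Ex\rangle+\langle P_Ex,-C_Ex\rangle\le-\sigma\|x\|^2\qquad\text{for all }x\in D(C_E).$$ Moreover the semigroup is exponentially stable: there are $M,\omega>0$ with $\|T_E(t)\|\le Me^{-\omega t}$ for all $t\ge0$. (b) With $a=2m_{HC}+1$ there are constants $c_1,c_2,\tau>0$ such that $$1-c_1t^a\le\|T_E(t)\|^2\le1-c_2t^a\qquad\text{for all }0\le t\le\tau.$$ -/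

import Mathlib

open Filter Topology
open scoped NNReal InnerProductSpace

noncomputable section

namespace Hypo

variable {𝕜 : Type*} [RCLike 𝕜]

section Bounded

variable {H : Type*} [NormedAddCommGroup H] [InnerProductSpace 𝕜 H] [CompleteSpace H]

/-- The Hermitian part `C_H = (C + C*) / 2` of a bounded operator. -/
def hermPart (C : H →L[𝕜] H) : H →L[𝕜] H :=
  (2 : 𝕜)⁻¹ • (C + ContinuousLinearMap.adjoint C)

/-- The skew-Hermitian part `C_S = (C - C*) / 2` of a bounded operator. -/
def skewPart (C : H →L[𝕜] H) : H →L[𝕜] H :=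
  (2 : 𝕜)⁻¹ • (C - ContinuousLinearMap.adjoint C)

/-- `C` is accretive if `C_H ≥ 0` in the Loewner order. -/
def IsAccretive (C : H →L[𝕜] H) : Prop :=
  0 ≤ hermPart C

/-- `∑_{j=0}^m C^j C_H (C*)^j ≥ κ 1` for some `κ > 0`, in the Loewner order. -/
def HypocoercivityBound (C : H →L[𝕜] H) (m : ℕ) : Prop :=
  ∃ κ : ℝ, 0 < κ ∧
    (κ : 𝕜) • (1 : H →L[𝕜] H) ≤
      ∑ j ∈ Finset.range (m + 1), C ^ j * hermPart C * (ContinuousLinearMap.adjoint C) ^ j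

/-- The accretive operator `C` is hypocoercive and `m` is its hypocoercivity index, that is, the
smallest natural number for which the hypocoercivity bound holds. -/
structure IsHypocoerciveWithIndex (C : H →L[𝕜] H) (m : ℕ) : Prop where
  accretive : IsAccretive C
  isLeast : IsLeast {k : ℕ | HypocoercivityBound C k} m

/-- The operator `C_η = η C_S + C_H`. -/
def modeOp (C : H →L[𝕜] H) (η : ℝ) : H →L[𝕜] H :=
  (η : 𝕜) • skewPart C + hermPart C

/-- The operator `∑_{j=0}^m η^{-2j} (C_η*)^j C_η^j` on a single mode. -/
def lyapunovMode (C : H →L[𝕜] H) (m : ℕ) (η : ℝ) : H →L[𝕜] H :=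
  ∑ j ∈ Finset.range (m + 1),
    (((η ^ (2 * j))⁻¹ : ℝ) : 𝕜) •
      ((ContinuousLinearMap.adjoint (modeOp C η)) ^ j * (modeOp C η) ^ j)

end Bounded

/-- The Hilbert direct sum `⊕_{η ∈ E} H` of copies of `H`. -/
abbrev ModalSpace (H : Type*) [NormedAddCommGroup H] (E : Set ℝ) : Type _ :=
  lp (fun _ : E => H) 2

/-- The operator `C_E (x_η)_η = (C_η x_η)_η`, with domain the set of those `x` in the direct sum
for which `(C_η x_η)_η` is square summable. -/
def modalOp {H : Type*} [NormedAddCommGroup H] [InnerProductSpace 𝕜 H] [CompleteSpace H]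
    (C : H →L[𝕜] H) (E : Set ℝ) : ModalSpace H E →ₗ.[𝕜] ModalSpace H E where
  domain :=
    { carrier := {x | Memℓp (fun η : E => modeOp C (η : ℝ) (x η)) 2}
      add_mem' := fun {x y} hx hy => by
        have h := Memℓp.add hx hy
        refine (congrArg (fun f : E → H => Memℓp f 2) ?_).mp h
        funext η
        simp
      zero_mem' := by
        refine (congrArg (fun f : E → H => Memℓp f 2) ?_).mp (zero_memℓp (E := fun _ : E => H))
        funext η
        simp
      smul_mem' := fun c x hx => by
        have h := Memℓp.const_smul hx c
        refine (congrArg (fun f : E → H => Memℓp f 2) ?_).mp h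
        funext η
        simp }
  toFun :=
    { toFun := fun x => ⟨fun η : E => modeOp C (η : ℝ) (x.1 η), x.2⟩
      map_add' := fun x y => by
        apply lp.ext
        funext η
        exact map_add (modeOp C (η : ℝ)) (x.1 η) (y.1 η)
      map_smul' := fun c x => by
        apply lp.ext
        funext η
        exact map_smul (modeOp C (η : ℝ)) c (x.1 η) }

section Semigroup

variable (𝕜) (X : Type*) [NormedAddCommGroup X] [NormedSpace 𝕜 X]

/-- A strongly continuous semigroup `(T(t))_{t ≥ 0}` of bounded operators on `X`. -/
structure C0Semigroup where
  /-- The operator at time `t`. -/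
  op : ℝ≥0 → X →L[𝕜] X
  op_zero : op 0 = 1
  op_add : ∀ s t : ℝ≥0, op (s + t) = op s * op t
  continuous_orbit : ∀ x : X, Continuous fun t : ℝ≥0 => op t x

variable {𝕜 X}

/-- The (possibly unbounded) operator `A` is the infinitesimal generator of `T`: `x ∈ D(A)` and
`A x = y` if and only if `(T(t) x - x) / t → y` as `t ↓ 0`. -/
def C0Semigroup.HasGenerator (T : C0Semigroup 𝕜 X) (A : X →ₗ.[𝕜] X) : Prop :=
  ∀ x y : X, (x, y) ∈ A.graph ↔
    Tendsto (fun t : ℝ≥0 => (((t : ℝ) : 𝕜))⁻¹ • (T.op t x - x)) (𝓝[>] 0) (𝓝 y)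

/-- Exponential stability: `‖T(t)‖ ≤ M e^{-ω t}` for all `t ≥ 0`, with `M, ω > 0`. -/
def C0Semigroup.ExponentiallyStable (T : C0Semigroup 𝕜 X) : Prop :=
  ∃ M ω : ℝ, 0 < M ∧ 0 < ω ∧ ∀ t : ℝ≥0, ‖T.op t‖ ≤ M * Real.exp (-(ω * (t : ℝ)))

end Semigroup

end Hypo

end

/-!
The dissipation along an orbit `u` of `exp(-t C_η)` is `d/dt ‖u‖² = -2 q(u)`, where `q` is the
quadratic form of the Hermitian part `C_H`, for every frequency `η`. The rescaled modes
`η⁻¹ C_η = C_S + η⁻¹ C_H`, `|η| ≥ 1`, stay in a bounded set and differ from each other, and from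
`-C*`, by bounded multiples of `C_H`. Expanding powers, each such perturbation contributes a factor
`C_H`, which `q` controls; hence the hypocoercivity bound is equivalent to
`∑_{j ≤ m} q((η⁻¹ C_η)^j x) ≥ κ ‖x‖²`, with one `κ` for all `η`
(`HypocoercivityBound.exists_uniform`, `HypocoercivityBound.of_scaledMode`). The left-hand side is
also `re ⟪C_η x, P_η x⟫` (`re_inner_modeOp_lyapunovMode`), which gives the Lyapunov inequality.

For the upper norm estimate, the Taylor coefficients `(-1)^j A^j x / j!`, `j ≤ m`, of an orbit of
`exp(-tA)` are recovered up to `O(r^(m+1))` by interpolation from the orbit at the times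
`r, 2r, …, (m+1)r`. The dissipation at these times is therefore at least of order `r^(2m)`, and
integration in `r` gives the loss of norm `≥ c t^(2m+1)` (`exists_short_time_decay`). With
`A = |η|⁻¹ C_η` and the rescaled time `|η| t` this is uniform in `η` as long as `|η| t` is bounded;
beyond that, iteration gives exponential decay at a rate independent of `η`
(`exists_modeOp_decay`). Exponential stability follows by iterating at a fixed time. For the lower
estimate, minimality of `m` provides vectors whose iterated dissipation of order below `m` is
arbitrarily small, and the orbits of these lose at most `O(t^(2m+1))`
(`exists_short_time_lower_bound`).

The semigroup acts diagonally on the Hilbert sum, and dominated convergence of series yields its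
strong continuity and its generator (`hasGenerator_modalSemigroup`). Any other semigroup with this
generator agrees with it on every single mode, where the generator is bounded
(`C0Semigroup.HasGenerator.op_single`), hence everywhere.
-/

noncomputable section

namespace Hypo

/-! ### The semigroup of a bounded operator -/

section

variable {𝕜 : Type*} [RCLike 𝕜] {H : Type*} [NormedAddCommGroup H] [InnerProductSpace 𝕜 H]

/-- The uniformly continuous semigroup `exp(-tA)` of a bounded operator `A`, for real `t`. -/
def flow (A : H →L[𝕜] H) (t : ℝ) : H →L[𝕜] H :=
  NormedSpace.exp ((t : 𝕜) • (-A))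

@[simp]
lemma flow_zero (A : H →L[𝕜] H) : flow A 0 = 1 := by
  simp [flow, NormedSpace.exp_zero]

lemma flow_real_smul (A : H →L[𝕜] H) (c t : ℝ) : flow ((c : 𝕜) • A) t = flow A (c * t) := by
  simp only [flow, RCLike.ofReal_mul]
  congr 1
  module

lemma commute_flow (A : H →L[𝕜] H) (t : ℝ) : Commute A (flow A t) :=
  (((Commute.refl A).neg_right).smul_right _).exp_right

variable [CompleteSpace H]

lemma flow_add (A : H →L[𝕜] H) (s t : ℝ) : flow A (s + t) = flow A s * flow A t := by
  have hc : Commute ((s : 𝕜) • (-A)) ((t : 𝕜) • (-A)) :=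
    ((Commute.refl (-A)).smul_left _).smul_right _
  rw [flow, RCLike.ofReal_add, add_smul]
  exact NormedSpace.exp_add_of_commute_of_mem_ball (𝕂 := 𝕜) hc
    ((NormedSpace.expSeries_radius_eq_top 𝕜 (H →L[𝕜] H)).symm ▸ edist_lt_top _ _)
    ((NormedSpace.expSeries_radius_eq_top 𝕜 (H →L[𝕜] H)).symm ▸ edist_lt_top _ _)

/-- Taylor's formula for `exp(-tA)`, with a remainder depending on `A` through `‖A‖` only. -/
lemma norm_flow_sub_taylor_le (A : H →L[𝕜] H) {t b : ℝ} (ht : 0 ≤ t) (hA : ‖A‖ ≤ b) (n : ℕ)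
    (x : H) :
    ‖flow A t x - ∑ j ∈ Finset.range n, (t : 𝕜) ^ j • (((-1) ^ j / (j.factorial : 𝕜)) • (A ^ j) x)‖
      ≤ (t * b) ^ n * Real.exp (t * b) * ‖x‖ := by
  have hb : 0 ≤ b := (norm_nonneg A).trans hA
  set Z : H →L[𝕜] H := (t : 𝕜) • (-A) with hZ
  have hZn : ‖Z‖ ≤ t * b := by
    rw [hZ, norm_smul, norm_neg, RCLike.norm_ofReal, abs_of_nonneg ht]
    gcongr
  have hs := NormedSpace.exp_series_hasSum_exp' (𝕂 := 𝕜) Z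
  have hsum : HasSum (fun i => (((i + n).factorial : 𝕜)⁻¹) • Z ^ (i + n))
      (NormedSpace.exp Z - ∑ j ∈ Finset.range n, ((j.factorial : 𝕜)⁻¹) • Z ^ j) :=
    (hasSum_nat_add_iff' n).mpr hs
  have hterm : ∀ j : ℕ, (((j.factorial : 𝕜)⁻¹) • Z ^ j) x
      = (t : 𝕜) ^ j • (((-1) ^ j / (j.factorial : 𝕜)) • (A ^ j) x) := by
    intro j
    rw [hZ, smul_pow, neg_pow A, smul_apply, smul_apply]
    have : ((-1 : H →L[𝕜] H) ^ j * A ^ j) x = ((-1 : 𝕜) ^ j) • (A ^ j) x := by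
      have h1 : (-1 : H →L[𝕜] H) ^ j = ((-1 : 𝕜) ^ j) • 1 := by
        rw [← one_pow (M := H →L[𝕜] H) j, ← smul_pow]; simp
      rw [h1]; simp
    rw [this, smul_smul, smul_smul, smul_smul]
    congr 1
    ring
  have hexp : HasSum (fun i : ℕ => (t * b) ^ n * ((t * b) ^ i / i.factorial))
      ((t * b) ^ n * Real.exp (t * b)) := by
    rw [Real.exp_eq_exp_ℝ]
    exact (NormedSpace.expSeries_div_hasSum_exp (t * b)).mul_left _
  have hbound : ‖NormedSpace.exp Z - ∑ j ∈ Finset.range n, ((j.factorial : 𝕜)⁻¹) • Z ^ j‖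
      ≤ (t * b) ^ n * Real.exp (t * b) := by
    refine hsum.norm_le_of_bounded hexp fun i => ?_
    rw [norm_smul, norm_inv, RCLike.norm_natCast]
    have hfac : (i.factorial : ℝ) ≤ ((i + n).factorial : ℝ) := by
      exact_mod_cast Nat.factorial_le (Nat.le_add_right i n)
    have hpow : ‖Z ^ (i + n)‖ ≤ (t * b) ^ (i + n) := by
      rcases Nat.eq_zero_or_pos (i + n) with h | h
      · rw [h, pow_zero, pow_zero]; exact ContinuousLinearMap.norm_id_le
      · exact (norm_pow_le' Z h).trans (by gcongr)
    calc ((i + n).factorial : ℝ)⁻¹ * ‖Z ^ (i + n)‖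
        ≤ (i.factorial : ℝ)⁻¹ * (t * b) ^ (i + n) := by
          gcongr
      _ = (t * b) ^ n * ((t * b) ^ i / i.factorial) := by rw [pow_add]; ring
  have key := (NormedSpace.exp Z - ∑ j ∈ Finset.range n,
    ((j.factorial : 𝕜)⁻¹) • Z ^ j).le_of_opNorm_le hbound x
  rw [sub_apply, sum_apply,
    Finset.sum_congr rfl fun j _ => hterm j] at key
  exact key

section RealStructure

variable [NormedSpace ℝ H] [IsScalarTower ℝ 𝕜 H]

lemma hasDerivAt_flow_apply (A : H →L[𝕜] H) (x : H) (t : ℝ) :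
    HasDerivAt (fun s : ℝ => flow A s x) (-(A (flow A t x))) t := by
  have h1 := hasDerivAt_exp_smul_const' (𝕂 := 𝕜) (-A) (t : 𝕜)
  have h2 : HasDerivAt (fun z : 𝕜 => NormedSpace.exp (z • (-A)) x) (-(A (flow A t x))) (t : 𝕜) := by
    have := h1.clm_apply (hasDerivAt_const (t : 𝕜) x)
    simpa [flow] using this
  have h3 : HasDerivAt (fun s : ℝ => (s : 𝕜)) 1 t := by
    simpa using (RCLike.ofRealCLM (K := 𝕜)).hasDerivAt (x := t)
  have h4 := h2.scomp t h3
  rw [one_smul] at h4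
  exact h4

end RealStructure

lemma hasDerivAt_norm_sq_flow (A : H →L[𝕜] H) (x : H) (t : ℝ) :
    HasDerivAt (fun s : ℝ => ‖flow A s x‖ ^ 2)
      (-2 * RCLike.re ⟪A (flow A t x), flow A t x⟫_𝕜) t := by
  let : InnerProductSpace ℝ H := InnerProductSpace.rclikeToReal 𝕜 H
  have : IsScalarTower ℝ 𝕜 H := inferInstance
  have h := (hasDerivAt_flow_apply A x t).norm_sq
  convert h using 1
  rw [real_inner_eq_re_inner 𝕜, inner_neg_right, map_neg, inner_re_symm]
  ring

lemma norm_sq_flow_antitone {A : H →L[𝕜] H} (hA : ∀ x, 0 ≤ RCLike.re ⟪A x, x⟫_𝕜) (x : H) :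
    Antitone fun t : ℝ => ‖flow A t x‖ ^ 2 :=
  antitone_of_hasDerivAt_nonpos (fun t => hasDerivAt_norm_sq_flow A x t)
    fun t => by have := hA (flow A t x); simp only [Pi.zero_apply]; linarith

lemma norm_flow_apply_le {A : H →L[𝕜] H} (hA : ∀ x, 0 ≤ RCLike.re ⟪A x, x⟫_𝕜) {t : ℝ}
    (ht : 0 ≤ t) (x : H) : ‖flow A t x‖ ≤ ‖x‖ := by
  have h := norm_sq_flow_antitone hA x ht
  simp only [flow_zero, one_apply_eq_self] at h
  exact (sq_le_sq₀ (norm_nonneg _) (norm_nonneg _)).mp h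

lemma continuous_flow_apply (A : H →L[𝕜] H) (x : H) : Continuous fun t : ℝ => flow A t x := by
  let : InnerProductSpace ℝ H := InnerProductSpace.rclikeToReal 𝕜 H
  have : IsScalarTower ℝ 𝕜 H := inferInstance
  exact continuous_iff_continuousAt.mpr fun t => (hasDerivAt_flow_apply A x t).continuousAt

/-- The increment of an orbit of a contraction semigroup is controlled by the generator. -/
lemma norm_flow_apply_sub_le {A : H →L[𝕜] H} (hA : ∀ x, 0 ≤ RCLike.re ⟪A x, x⟫_𝕜) {t : ℝ}
    (ht : 0 ≤ t) (x : H) : ‖flow A t x - x‖ ≤ t * ‖A x‖ := by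
  let : InnerProductSpace ℝ H := InnerProductSpace.rclikeToReal 𝕜 H
  have : IsScalarTower ℝ 𝕜 H := inferInstance
  have hcomm : ∀ s, A (flow A s x) = flow A s (A x) := fun s =>
    DFunLike.congr_fun (commute_flow A s).eq x
  have h := norm_image_sub_le_of_norm_deriv_le_segment' (f := fun s : ℝ => flow A s x)
    (a := 0) (b := t) (C := ‖A x‖)
    (fun s _ => (hasDerivAt_flow_apply A x s).hasDerivWithinAt)
    (fun s hs => by rw [norm_neg, hcomm]; exact norm_flow_apply_le hA hs.1 _)
    t ⟨ht, le_rfl⟩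
  simpa [mul_comm] using h

/-- The difference quotients of an orbit at `0`, with respect to the scalar field `𝕜`. -/
lemma tendsto_flow_slope (A : H →L[𝕜] H) (x : H) :
    Tendsto (fun t : ℝ => ((t : 𝕜))⁻¹ • (flow A t x - x)) (𝓝[>] 0) (𝓝 (-(A x))) := by
  let : InnerProductSpace ℝ H := InnerProductSpace.rclikeToReal 𝕜 H
  have : IsScalarTower ℝ 𝕜 H := inferInstance
  have h := (hasDerivAt_flow_apply A x 0).tendsto_slope_zero_right
  simp only [zero_add, flow_zero, one_apply_eq_self] at h
  refine h.congr fun t => ?_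
  rw [← RCLike.ofReal_inv, RCLike.real_smul_eq_coe_smul (K := 𝕜)]

end

/-! ### Iterated coercivity and its transfer between modes -/

section

variable {𝕜 : Type*} [RCLike 𝕜] {H : Type*} [NormedAddCommGroup H] [InnerProductSpace 𝕜 H]

section PositiveForm

variable {Q : H →L[𝕜] H}

lemma reApplyInnerSelf_add_le (hQ : Q.IsPositive) (x y : H) :
    Q.reApplyInnerSelf (x + y) ≤ 2 * Q.reApplyInnerSelf x + 2 * Q.reApplyInnerSelf y := by
  have h := hQ.re_inner_nonneg_left (x - y)
  simp only [ContinuousLinearMap.reApplyInnerSelf_apply, map_sub, map_add, inner_sub_left,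
    inner_sub_right, inner_add_left, inner_add_right] at h ⊢
  linarith

lemma reApplyInnerSelf_sum_range_le (hQ : Q.IsPositive) (n : ℕ) (x : ℕ → H) :
    Q.reApplyInnerSelf (∑ i ∈ Finset.range n, x i)
      ≤ 2 ^ n * ∑ i ∈ Finset.range n, Q.reApplyInnerSelf (x i) := by
  induction n with
  | zero => simp [ContinuousLinearMap.reApplyInnerSelf_apply]
  | succ n ih =>
    rw [Finset.sum_range_succ, Finset.sum_range_succ, pow_succ]
    have h1 := reApplyInnerSelf_add_le hQ (∑ i ∈ Finset.range n, x i) (x n)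
    have h2 : 0 ≤ Q.reApplyInnerSelf (x n) := hQ.re_inner_nonneg_left _
    have h3 : (1 : ℝ) ≤ 2 ^ n := one_le_pow₀ one_le_two
    nlinarith

lemma reApplyInnerSelf_smul (x : H) (c : 𝕜) :
    Q.reApplyInnerSelf (c • x) = ‖c‖ ^ 2 * Q.reApplyInnerSelf x := Q.reApplyInnerSelf_smul x

lemma reApplyInnerSelf_le (x : H) : Q.reApplyInnerSelf x ≤ ‖Q‖ * ‖x‖ ^ 2 := by
  rw [ContinuousLinearMap.reApplyInnerSelf_apply]
  calc RCLike.re ⟪Q x, x⟫_𝕜 ≤ ‖Q x‖ * ‖x‖ := re_inner_le_norm _ _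
    _ ≤ ‖Q‖ * ‖x‖ * ‖x‖ := by gcongr; exact Q.le_opNorm x
    _ = ‖Q‖ * ‖x‖ ^ 2 := by ring

/-- For positive `Q`, the vector `Q x` is controlled by the quadratic form of `Q`. -/
lemma norm_sq_apply_le_reApplyInnerSelf (hQ : Q.IsPositive) (x : H) :
    ‖Q x‖ ^ 2 ≤ ‖Q‖ * Q.reApplyInnerSelf x := by
  rcases eq_or_ne Q 0 with rfl | h0
  · simp
  have hpos : 0 < ‖Q‖ := norm_pos_iff.mpr h0
  set c : ℝ := ‖Q‖⁻¹ with hc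
  -- positivity of the form at `x - ‖Q‖⁻¹ Q x`
  have h := hQ.re_inner_nonneg_left (x - (c : 𝕜) • Q x)
  have hsym : RCLike.re ⟪Q (Q x), x⟫_𝕜 = ‖Q x‖ ^ 2 := by
    rw [hQ.inner_left_eq_inner_right, inner_self_eq_norm_sq]
  have hself : RCLike.re ⟪Q x, Q x⟫_𝕜 = ‖Q x‖ ^ 2 := inner_self_eq_norm_sq _
  have hQQ := reApplyInnerSelf_le (Q := Q) (Q x)
  rw [ContinuousLinearMap.reApplyInnerSelf_apply] at hQQ ⊢
  simp only [map_sub, map_smul, inner_sub_left, inner_sub_right, inner_smul_left,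
    inner_smul_right, RCLike.conj_ofReal, RCLike.re_ofReal_mul, hsym, hself] at h
  have hc' : c * ‖Q‖ = 1 := inv_mul_cancel₀ hpos.ne'
  have hcpos : 0 < c := inv_pos.mpr hpos
  have h2 : c * (c * RCLike.re ⟪Q (Q x), Q x⟫_𝕜) ≤ c * ‖Q x‖ ^ 2 := by
    gcongr
    calc c * RCLike.re ⟪Q (Q x), Q x⟫_𝕜 ≤ c * (‖Q‖ * ‖Q x‖ ^ 2) := by gcongr
      _ = ‖Q x‖ ^ 2 := by rw [← mul_assoc, hc', one_mul]
  have h3 : c * ‖Q x‖ ^ 2 ≤ RCLike.re ⟪Q x, x⟫_𝕜 := by linarith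
  calc ‖Q x‖ ^ 2 = ‖Q‖ * (c * ‖Q x‖ ^ 2) := by rw [← mul_assoc, mul_comm ‖Q‖, hc', one_mul]
    _ ≤ _ := by gcongr

/-- The iterated dissipation of a perturbation `B + c Q` is controlled by that of `B`: expanding
the power, every term that contains a perturbation has a factor `Q B^i x`, whose norm the form of
`Q` at `B^i x` controls. The constant depends on norm bounds only. -/
lemma exists_reApplyInnerSelf_pow_le (hQ : Q.IsPositive) (b : ℝ) (j : ℕ) :
    ∃ K : ℝ, 0 ≤ K ∧ ∀ (B B' : H →L[𝕜] H) (c : 𝕜), ‖B'‖ ≤ b → ‖c‖ ≤ 2 → B' = B + c • Q → ∀ x : H,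
      Q.reApplyInnerSelf ((B' ^ j) x)
        ≤ K * ∑ i ∈ Finset.range (j + 1), Q.reApplyInnerSelf ((B ^ i) x) := by
  induction j with
  | zero => exact ⟨1, zero_le_one, fun B B' c _ _ _ x => by simp⟩
  | succ j ih =>
    obtain ⟨K, hK, h⟩ := ih
    refine ⟨2 * K + 8 * ‖Q‖ ^ 2 * (b ^ j) ^ 2, by positivity, fun B B' c hb hc hB x => ?_⟩
    have hq0 : ∀ y, 0 ≤ Q.reApplyInnerSelf y := hQ.re_inner_nonneg_left
    have hsplit : (B' ^ (j + 1)) x = (B' ^ j) (B x) + c • (B' ^ j) (Q x) := by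
      have : B' x = B x + c • Q x := by rw [hB]; simp
      rw [pow_succ, mul_apply_eq_comp, this, map_add, map_smul]
    have hB'j : ‖(B' ^ j) (Q x)‖ ≤ b ^ j * ‖Q x‖ := by
      refine (B' ^ j).le_of_opNorm_le ?_ _
      rcases Nat.eq_zero_or_pos j with rfl | hj
      · rw [pow_zero, pow_zero]; exact ContinuousLinearMap.norm_id_le
      · exact (norm_pow_le' B' hj).trans (by gcongr)
    have h1 := h B B' c hb hc hB (B x)
    have h2 : Q.reApplyInnerSelf (c • (B' ^ j) (Q x))
        ≤ 4 * ‖Q‖ ^ 2 * (b ^ j) ^ 2 * Q.reApplyInnerSelf x := by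
      rw [reApplyInnerSelf_smul]
      calc ‖c‖ ^ 2 * Q.reApplyInnerSelf ((B' ^ j) (Q x))
          ≤ 2 ^ 2 * (‖Q‖ * (b ^ j * ‖Q x‖) ^ 2) := by
            gcongr
            · exact hq0 _
            · exact (reApplyInnerSelf_le _).trans (by gcongr)
        _ = 4 * ‖Q‖ * (b ^ j) ^ 2 * ‖Q x‖ ^ 2 := by ring
        _ ≤ 4 * ‖Q‖ * (b ^ j) ^ 2 * (‖Q‖ * Q.reApplyInnerSelf x) := by
            gcongr
            exact norm_sq_apply_le_reApplyInnerSelf hQ x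
        _ = _ := by ring
    have h3 := reApplyInnerSelf_add_le hQ ((B' ^ j) (B x)) (c • (B' ^ j) (Q x))
    have hshift : ∀ i, (B ^ i) (B x) = (B ^ (i + 1)) x := fun i => by
      rw [pow_succ, mul_apply_eq_comp]
    have hS := Finset.sum_range_succ' (fun i => Q.reApplyInnerSelf ((B ^ i) x)) (j + 1)
    simp only [hshift] at h1
    simp only [pow_zero, one_apply_eq_self] at hS
    have hx := hq0 x
    have hS0 : 0 ≤ ∑ i ∈ Finset.range (j + 1), Q.reApplyInnerSelf ((B ^ (i + 1)) x) :=
      Finset.sum_nonneg fun i _ => hq0 _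
    rw [hsplit, hS]
    have e1 : 0 ≤ 8 * ‖Q‖ ^ 2 * (b ^ j) ^ 2 *
        ∑ i ∈ Finset.range (j + 1), Q.reApplyInnerSelf ((B ^ (i + 1)) x) := by positivity
    have e2 : 0 ≤ 2 * K * Q.reApplyInnerSelf x := by positivity
    linarith

/-- Uniform transfer of the iterated coercivity bound from `B'` to `B` when `B' - B` is a multiple
of `Q`. -/
lemma exists_coercive_transfer (hQ : Q.IsPositive) (b : ℝ) (n : ℕ) {κ : ℝ} (hκ : 0 < κ) :
    ∃ κ' : ℝ, 0 < κ' ∧ ∀ (B B' : H →L[𝕜] H) (c : 𝕜), ‖B'‖ ≤ b → ‖c‖ ≤ 2 → B' = B + c • Q →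
      (∀ x : H, κ * ‖x‖ ^ 2 ≤ ∑ j ∈ Finset.range n, Q.reApplyInnerSelf ((B' ^ j) x)) →
      ∀ x : H, κ' * ‖x‖ ^ 2 ≤ ∑ j ∈ Finset.range n, Q.reApplyInnerSelf ((B ^ j) x) := by
  choose K hK h using fun j => exists_reApplyInnerSelf_pow_le hQ b j
  have hq0 : ∀ y, 0 ≤ Q.reApplyInnerSelf y := hQ.re_inner_nonneg_left
  set S : ℝ := ∑ j ∈ Finset.range n, K j with hS
  have hS0 : 0 ≤ S := Finset.sum_nonneg fun j _ => hK j
  refine ⟨κ / (S + 1), by positivity, fun B B' c hb hc hB hco x => ?_⟩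
  have h1 : ∑ j ∈ Finset.range n, Q.reApplyInnerSelf ((B' ^ j) x)
      ≤ S * ∑ i ∈ Finset.range n, Q.reApplyInnerSelf ((B ^ i) x) := by
    rw [hS, Finset.sum_mul]
    refine Finset.sum_le_sum fun j hj => (h j B B' c hb hc hB x).trans ?_
    gcongr
    · exact hK j
    · exact fun i _ _ => hq0 _
    · exact Nat.succ_le_of_lt (Finset.mem_range.mp hj)
  have h2 : 0 ≤ ∑ i ∈ Finset.range n, Q.reApplyInnerSelf ((B ^ i) x) :=
    Finset.sum_nonneg fun i _ => hq0 _
  rw [div_mul_eq_mul_div, div_le_iff₀ (by positivity)]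
  linarith [hco x]

end PositiveForm

section Modes

variable [CompleteSpace H]

lemma hermPart_sub_skewPart (C : H →L[𝕜] H) :
    hermPart C - skewPart C = ContinuousLinearMap.adjoint C := by
  rw [hermPart, skewPart, ← smul_sub, add_sub_sub_cancel,
    ← two_smul 𝕜 (ContinuousLinearMap.adjoint C), smul_smul, inv_mul_cancel₀ two_ne_zero, one_smul]

lemma IsAccretive.isPositive {C : H →L[𝕜] H} (h : IsAccretive C) : (hermPart C).IsPositive :=
  (ContinuousLinearMap.nonneg_iff_isPositive _).mp h

lemma re_inner_skewPart (C : H →L[𝕜] H) (x : H) : RCLike.re ⟪skewPart C x, x⟫_𝕜 = 0 := by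
  have h : RCLike.re ⟪ContinuousLinearMap.adjoint C x, x⟫_𝕜 = RCLike.re ⟪C x, x⟫_𝕜 := by
    rw [ContinuousLinearMap.adjoint_inner_left, inner_re_symm]
  have h2 : ((2 : 𝕜)⁻¹) = ((2⁻¹ : ℝ) : 𝕜) := by rw [RCLike.ofReal_inv, RCLike.ofReal_ofNat]
  rw [skewPart, h2, smul_apply, inner_smul_left, RCLike.conj_ofReal, RCLike.re_ofReal_mul,
    sub_apply, inner_sub_left, map_sub, h, sub_self, mul_zero]

lemma re_inner_modeOp (C : H →L[𝕜] H) (η : ℝ) (x : H) :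
    RCLike.re ⟪modeOp C η x, x⟫_𝕜 = (hermPart C).reApplyInnerSelf x := by
  rw [modeOp, add_apply, smul_apply, inner_add_left, inner_smul_left, map_add, RCLike.conj_ofReal,
    RCLike.re_ofReal_mul, re_inner_skewPart, mul_zero, zero_add,
    ContinuousLinearMap.reApplyInnerSelf_apply]

lemma re_inner_modeOp_nonneg {C : H →L[𝕜] H} (hC : IsAccretive C) (η : ℝ) (x : H) :
    0 ≤ RCLike.re ⟪modeOp C η x, x⟫_𝕜 := by
  rw [re_inner_modeOp]
  exact hC.isPositive.re_inner_nonneg_left x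

/-- The hypocoercivity bound in terms of the quadratic form of the Hermitian part. -/
lemma hypocoercivityBound_iff {C : H →L[𝕜] H} (hC : IsAccretive C) (m : ℕ) :
    HypocoercivityBound C m ↔ ∃ κ : ℝ, 0 < κ ∧ ∀ x : H, κ * ‖x‖ ^ 2 ≤
      ∑ j ∈ Finset.range (m + 1),
        (hermPart C).reApplyInnerSelf ((ContinuousLinearMap.adjoint C ^ j) x) := by
  have hpow : ∀ j, C ^ j = ContinuousLinearMap.adjoint (ContinuousLinearMap.adjoint C ^ j) := by
    intro j
    rw [← ContinuousLinearMap.star_eq_adjoint, ← ContinuousLinearMap.star_eq_adjoint, star_pow,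
      star_star]
  have hterm : ∀ (j : ℕ) (x : H),
      RCLike.re ⟪(C ^ j * hermPart C * ContinuousLinearMap.adjoint C ^ j) x, x⟫_𝕜
        = (hermPart C).reApplyInnerSelf ((ContinuousLinearMap.adjoint C ^ j) x) := by
    intro j x
    rw [mul_apply_eq_comp, mul_apply_eq_comp, hpow j,
      ContinuousLinearMap.adjoint_inner_left, ContinuousLinearMap.reApplyInnerSelf_apply]
  have hsum : (∑ j ∈ Finset.range (m + 1),
      C ^ j * hermPart C * ContinuousLinearMap.adjoint C ^ j).IsPositive := by
    refine ContinuousLinearMap.isPositive_sum _ fun j _ => ?_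
    have := hC.isPositive.conj_adjoint (C ^ j)
    rwa [hpow j, ContinuousLinearMap.adjoint_adjoint, ← hpow j] at this
  have hone : ∀ κ : ℝ, 0 < κ → ((κ : 𝕜) • (1 : H →L[𝕜] H)).IsPositive := fun κ hκ =>
    ContinuousLinearMap.isPositive_one.smul_of_nonneg (by exact_mod_cast hκ.le)
  refine exists_congr fun κ => and_congr_right fun hκ => ?_
  rw [ContinuousLinearMap.le_def, ContinuousLinearMap.isPositive_def']
  have hsa := (hsum.isSelfAdjoint).sub (hone κ hκ).isSelfAdjoint
  refine ⟨fun h x => ?_, fun h => ⟨hsa, fun x => ?_⟩⟩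
  · have := h.2 x
    rw [ContinuousLinearMap.reApplyInnerSelf_apply, sub_apply, inner_sub_left, map_sub, sum_apply,
      sum_inner, map_sum, Finset.sum_congr rfl fun j _ => hterm j x, smul_apply,
      inner_smul_left, RCLike.conj_ofReal, RCLike.re_ofReal_mul, one_apply_eq_self,
      inner_self_eq_norm_sq] at this
    linarith
  · rw [ContinuousLinearMap.reApplyInnerSelf_apply, sub_apply, inner_sub_left, map_sub, sum_apply,
      sum_inner, map_sum, Finset.sum_congr rfl fun j _ => hterm j x, smul_apply,
      inner_smul_left, RCLike.conj_ofReal, RCLike.re_ofReal_mul, one_apply_eq_self,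
      inner_self_eq_norm_sq]
    linarith [h x]

/-- The mode operator rescaled by its frequency, `η⁻¹ C_η = C_S + η⁻¹ C_H`. For `|η| ≥ 1` these
operators stay in a bounded set. -/
def scaledMode (C : H →L[𝕜] H) (η : ℝ) : H →L[𝕜] H :=
  ((η⁻¹ : ℝ) : 𝕜) • modeOp C η

lemma scaledMode_eq (C : H →L[𝕜] H) {η : ℝ} (hη : η ≠ 0) :
    scaledMode C η = skewPart C + ((η⁻¹ : ℝ) : 𝕜) • hermPart C := by
  rw [scaledMode, modeOp, smul_add, smul_smul, ← RCLike.ofReal_mul, inv_mul_cancel₀ hη,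
    RCLike.ofReal_one, one_smul]

lemma norm_scaledMode_le (C : H →L[𝕜] H) {η : ℝ} (hη : 1 ≤ |η|) :
    ‖scaledMode C η‖ ≤ ‖skewPart C‖ + ‖hermPart C‖ := by
  have h0 : η ≠ 0 := abs_pos.mp (zero_lt_one.trans_le hη)
  rw [scaledMode_eq C h0]
  refine (norm_add_le _ _).trans ?_
  gcongr
  rw [norm_smul, RCLike.norm_ofReal, abs_inv]
  exact mul_le_of_le_one_left (norm_nonneg _) (inv_le_one_of_one_le₀ hη)

lemma scaledMode_pow_apply (C : H →L[𝕜] H) (η : ℝ) (j : ℕ) (x : H) :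
    (scaledMode C η ^ j) x = (((η ^ j)⁻¹ : ℝ) : 𝕜) • (modeOp C η ^ j) x := by
  rw [scaledMode, smul_pow, smul_apply, ← RCLike.ofReal_pow, inv_pow]

lemma reApplyInnerSelf_neg_adjoint_pow (C Q : H →L[𝕜] H) (j : ℕ) (x : H) :
    Q.reApplyInnerSelf (((-ContinuousLinearMap.adjoint C) ^ j) x)
      = Q.reApplyInnerSelf ((ContinuousLinearMap.adjoint C ^ j) x) := by
  rcases neg_one_pow_eq_or (H →L[𝕜] H) j with h | h <;>
    rw [neg_pow, h] <;> simp [ContinuousLinearMap.reApplyInnerSelf_apply]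

/-- Hypocoercivity gives iterated coercivity of all rescaled modes `η⁻¹ C_η`, `|η| ≥ 1`, with one
constant, since each of them differs from `-C*` by a bounded multiple of `C_H`. -/
lemma HypocoercivityBound.exists_uniform {C : H →L[𝕜] H} {m : ℕ} (hC : IsAccretive C)
    (h : HypocoercivityBound C m) :
    ∃ κ : ℝ, 0 < κ ∧ ∀ η : ℝ, 1 ≤ |η| → ∀ x : H, κ * ‖x‖ ^ 2 ≤
      ∑ j ∈ Finset.range (m + 1), (hermPart C).reApplyInnerSelf ((scaledMode C η ^ j) x) := by
  obtain ⟨κ₀, hκ₀, hco⟩ := (hypocoercivityBound_iff hC m).mp h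
  obtain ⟨κ, hκ, htr⟩ := exists_coercive_transfer hC.isPositive
    ‖-ContinuousLinearMap.adjoint C‖ (m + 1) hκ₀
  refine ⟨κ, hκ, fun η hη => htr (scaledMode C η) (-ContinuousLinearMap.adjoint C)
    ((-1 - η⁻¹ : ℝ) : 𝕜) le_rfl ?_ ?_ ?_⟩
  · rw [RCLike.norm_ofReal, abs_le]
    have := abs_le.mp ((abs_inv η).trans_le (inv_le_one_of_one_le₀ hη))
    constructor <;> linarith
  · have h0 : η ≠ 0 := abs_pos.mp (zero_lt_one.trans_le hη)
    rw [scaledMode_eq C h0, ← hermPart_sub_skewPart C]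
    push_cast
    module
  · simpa only [reApplyInnerSelf_neg_adjoint_pow] using hco

/-- Conversely, iterated coercivity of a single rescaled mode gives the hypocoercivity bound. -/
lemma HypocoercivityBound.of_scaledMode {C : H →L[𝕜] H} {m : ℕ} (hC : IsAccretive C) {η κ : ℝ}
    (hη : 1 ≤ |η|) (hκ : 0 < κ) (h : ∀ x : H, κ * ‖x‖ ^ 2 ≤
      ∑ j ∈ Finset.range (m + 1), (hermPart C).reApplyInnerSelf ((scaledMode C η ^ j) x)) :
    HypocoercivityBound C m := by
  obtain ⟨κ', hκ', htr⟩ := exists_coercive_transfer hC.isPositive ‖scaledMode C η‖ (m + 1) hκ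
  have := htr (-ContinuousLinearMap.adjoint C) (scaledMode C η) ((1 + η⁻¹ : ℝ) : 𝕜) le_rfl ?_ ?_ h
  · simp only [reApplyInnerSelf_neg_adjoint_pow] at this
    exact (hypocoercivityBound_iff hC m).mpr ⟨κ', hκ', this⟩
  · rw [RCLike.norm_ofReal, abs_le]
    have := abs_le.mp ((abs_inv η).trans_le (inv_le_one_of_one_le₀ hη))
    constructor <;> linarith
  · have h0 : η ≠ 0 := abs_pos.mp (zero_lt_one.trans_le hη)
    rw [scaledMode_eq C h0, ← hermPart_sub_skewPart C]
    push_cast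
    module

end Modes

end

/-! ### Short-time estimates for bounded generators -/

section

variable {𝕜 : Type*} [RCLike 𝕜] {H : Type*} [NormedAddCommGroup H] [InnerProductSpace 𝕜 H]
  [CompleteSpace H]

/-- The coefficients of a vector polynomial of degree `m` are combinations, with weights that
depend on `m` only, of its values at the nodes `1, …, m + 1`. -/
lemma exists_interpolation_weights (𝕜 : Type*) [RCLike 𝕜] (m : ℕ) :
    ∃ W : ℕ → ℕ → 𝕜, ∀ {V : Type*} [AddCommGroup V] [Module 𝕜 V] (y : ℕ → V), ∀ j ≤ m,
      ∑ k ∈ Finset.range (m + 1), W j k •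
        (∑ i ∈ Finset.range (m + 1), ((k : 𝕜) + 1) ^ i • y i) = y j := by
  set v : Fin (m + 1) → 𝕜 := fun k => (k : 𝕜) + 1 with hv
  have hinj : Function.Injective v := fun a b h => by
    have : ((a : ℕ) : 𝕜) = ((b : ℕ) : 𝕜) := add_right_cancel h
    exact Fin.ext (Nat.cast_injective this)
  have hdet : IsUnit (Matrix.vandermonde v).det :=
    isUnit_iff_ne_zero.mpr (Matrix.det_vandermonde_ne_zero_iff.mpr hinj)
  have hinv := Matrix.nonsing_inv_mul _ hdet
  set M := (Matrix.vandermonde v)⁻¹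
  refine ⟨fun j k => if h : j < m + 1 ∧ k < m + 1 then M ⟨j, h.1⟩ ⟨k, h.2⟩ else 0,
    fun {V} _ _ y j hj => ?_⟩
  have hj' : j < m + 1 := Nat.lt_succ_of_le hj
  rw [Finset.sum_range]
  simp only [Finset.sum_range (n := m + 1), hj', Fin.is_lt, and_self, dite_true, Fin.eta]
  simp only [Finset.smul_sum, smul_smul]
  rw [Finset.sum_comm]
  simp only [← Finset.sum_smul]
  have : ∀ i : Fin (m + 1), ∑ k : Fin (m + 1), M ⟨j, hj'⟩ k * ((k : 𝕜) + 1) ^ (i : ℕ)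
      = (1 : Matrix (Fin (m + 1)) (Fin (m + 1)) 𝕜) ⟨j, hj'⟩ i := by
    intro i
    rw [← hinv, Matrix.mul_apply]
    rfl
  simp only [this, Matrix.one_apply, ite_smul, one_smul, zero_smul]
  simp

/-- Key observability estimate: for generators `A` in a bounded set with iterated coercivity of
order `m`, sampling the dissipation along the orbit at the times `r, 2r, …, (m+1)r` detects at least
a multiple of `r^(2m)`. Up to `O(r^(m+1))` the orbit is its Taylor polynomial, whose coefficients
are recovered by interpolation. -/
lemma exists_sampled_dissipation_lower_bound {Q : H →L[𝕜] H} (hQ : Q.IsPositive) (m : ℕ)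
    {b κ : ℝ} (hb : 0 ≤ b) (hκ : 0 < κ) :
    ∃ c r₀ : ℝ, 0 < c ∧ 0 < r₀ ∧ ∀ A : H →L[𝕜] H, ‖A‖ ≤ b →
      (∀ x : H, κ * ‖x‖ ^ 2 ≤ ∑ j ∈ Finset.range (m + 1), Q.reApplyInnerSelf ((A ^ j) x)) →
      ∀ (x : H) (r : ℝ), 0 ≤ r → r ≤ r₀ →
        c * r ^ (2 * m) * ‖x‖ ^ 2 ≤
          ∑ k ∈ Finset.range (m + 1), Q.reApplyInnerSelf (flow A ((k + 1) * r) x) := by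
  obtain ⟨W, hW⟩ := exists_interpolation_weights 𝕜 m
  have hq0 : ∀ y, 0 ≤ Q.reApplyInnerSelf y := hQ.re_inner_nonneg_left
  obtain ⟨w, hw1, hw⟩ : ∃ w : ℝ, 1 ≤ w ∧ ∀ j ∈ Finset.range (m + 1), ∀ k ∈ Finset.range (m + 1),
      ‖W j k‖ ^ 2 ≤ w := by
    refine ⟨1 + ∑ j ∈ Finset.range (m + 1), ∑ k ∈ Finset.range (m + 1), ‖W j k‖ ^ 2, ?_, ?_⟩
    · have : 0 ≤ ∑ j ∈ Finset.range (m + 1), ∑ k ∈ Finset.range (m + 1), ‖W j k‖ ^ 2 := by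
        positivity
      linarith
    · intro j hj k hk
      have h1 := Finset.single_le_sum (f := fun k => ‖W j k‖ ^ 2)
        (fun _ _ => by positivity) hk
      have h2 := Finset.single_le_sum (f := fun j => ∑ k ∈ Finset.range (m + 1), ‖W j k‖ ^ 2)
        (fun _ _ => by positivity) hj
      exact (h1.trans h2).trans (le_add_of_nonneg_left zero_le_one)
  -- the Taylor remainder at time `(k + 1) r`, `r ≤ 1`, is at most `K₁ r ^ (m + 1) ‖x‖`
  set K₁ : ℝ := ((m + 1) * b) ^ (m + 1) * Real.exp ((m + 1) * b) with hK₁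
  have hK₁0 : 0 ≤ K₁ := by positivity
  set L : ℝ := (m + 1) * 2 ^ (m + 1) * w with hL
  have hL0 : 0 < L := by positivity
  set κ' : ℝ := κ / (m.factorial : ℝ) ^ 2 with hκ'
  have hκ'0 : 0 < κ' := by positivity
  set K₂ : ℝ := L * (m + 1) * (2 * (‖Q‖ * K₁ ^ 2)) with hK₂
  have hK₂0 : 0 ≤ K₂ := by positivity
  refine ⟨κ' / (4 * L), min 1 (κ' / (2 * (K₂ + 1))), by positivity, by positivity,
    fun A hA hco x r hr hr0 => ?_⟩
  have hr1 : r ≤ 1 := hr0.trans (min_le_left _ _)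
  have hrK : K₂ * r ^ 2 ≤ κ' / 2 := by
    have h1 : r ≤ κ' / (2 * (K₂ + 1)) := hr0.trans (min_le_right _ _)
    rw [le_div_iff₀ (by positivity)] at h1
    have h2 : r ^ 2 ≤ r := by nlinarith
    nlinarith
  set y : ℕ → H := fun j => ((-1) ^ j / (j.factorial : 𝕜)) • (A ^ j) x with hy
  set p : ℕ → H := fun k =>
    ∑ i ∈ Finset.range (m + 1), ((k : 𝕜) + 1) ^ i • ((r : 𝕜) ^ i • y i) with hp
  -- comparison of the Taylor polynomial with the orbit
  have hpu : ∀ k ∈ Finset.range (m + 1), Q.reApplyInnerSelf (p k) ≤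
      2 * Q.reApplyInnerSelf (flow A ((k + 1) * r) x)
        + 2 * (‖Q‖ * K₁ ^ 2) * (r ^ (2 * m) * r ^ 2) * ‖x‖ ^ 2 := by
    intro k hk
    have hkm : (k : ℝ) ≤ m := by exact_mod_cast Nat.lt_succ_iff.mp (Finset.mem_range.mp hk)
    have hT := norm_flow_sub_taylor_le A (t := (k + 1) * r) (by positivity) hA (m + 1) x
    have hpk : ∑ j ∈ Finset.range (m + 1), ((((k : ℝ) + 1) * r : ℝ) : 𝕜) ^ j •
        (((-1) ^ j / (j.factorial : 𝕜)) • (A ^ j) x) = p k := by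
      refine Finset.sum_congr rfl fun j _ => ?_
      rw [hy, smul_smul ((k + 1 : 𝕜) ^ j), ← mul_pow]
      push_cast
      rfl
    rw [hpk] at hT
    have hrem : ((k + 1) * r * b) ^ (m + 1) * Real.exp ((k + 1) * r * b) ≤ K₁ * r ^ (m + 1) := by
      have e1 : ((k : ℝ) + 1) * r * b ≤ ((m + 1) * b) * r := by nlinarith [mul_nonneg hr hb]
      have e2 : ((k : ℝ) + 1) * r * b ≤ (m + 1) * b :=
        e1.trans (mul_le_of_le_one_right (by positivity) hr1)
      calc _ ≤ (((m + 1) * b) * r) ^ (m + 1) * Real.exp ((m + 1) * b) := by gcongr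
        _ = _ := by rw [mul_pow, hK₁]; ring
    have hT2 : ‖p k - flow A ((k + 1) * r) x‖ ^ 2 ≤ (K₁ * r ^ (m + 1) * ‖x‖) ^ 2 := by
      rw [norm_sub_rev]
      gcongr
      exact hT.trans (by gcongr)
    have h1 := reApplyInnerSelf_add_le hQ (flow A ((k + 1) * r) x)
      (p k - flow A ((k + 1) * r) x)
    rw [add_sub_cancel] at h1
    have h2 := (reApplyInnerSelf_le (Q := Q) (p k - flow A ((k + 1) * r) x)).trans
      (mul_le_mul_of_nonneg_left hT2 (norm_nonneg Q))
    calc _ ≤ _ := h1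
      _ ≤ 2 * Q.reApplyInnerSelf (flow A ((k + 1) * r) x)
          + 2 * (‖Q‖ * (K₁ * r ^ (m + 1) * ‖x‖) ^ 2) := by gcongr
      _ = _ := by ring
  -- interpolation bounds the coefficients of the polynomial by its values
  have hcoef : ∀ j ∈ Finset.range (m + 1), Q.reApplyInnerSelf ((r : 𝕜) ^ j • y j) ≤
      2 ^ (m + 1) * w * ∑ k ∈ Finset.range (m + 1), Q.reApplyInnerSelf (p k) := by
    intro j hj
    rw [← hW (fun i => (r : 𝕜) ^ i • y i) j (Nat.lt_succ_iff.mp (Finset.mem_range.mp hj))]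
    refine (reApplyInnerSelf_sum_range_le hQ _ _).trans ?_
    rw [mul_assoc, Finset.mul_sum (a := w)]
    gcongr with k hk
    rw [reApplyInnerSelf_smul]
    exact mul_le_mul_of_nonneg_right (hw j hj k hk) (hq0 _)
  have hlow : ∀ j ∈ Finset.range (m + 1),
      r ^ (2 * m) / (m.factorial : ℝ) ^ 2 * Q.reApplyInnerSelf ((A ^ j) x)
        ≤ Q.reApplyInnerSelf ((r : 𝕜) ^ j • y j) := by
    intro j hj
    have hjm : j ≤ m := Nat.lt_succ_iff.mp (Finset.mem_range.mp hj)
    rw [hy, reApplyInnerSelf_smul, reApplyInnerSelf_smul, ← mul_assoc]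
    refine mul_le_mul_of_nonneg_right ?_ (hq0 _)
    rw [norm_div, norm_pow, norm_pow, norm_neg, norm_one, one_pow, RCLike.norm_natCast,
      RCLike.norm_ofReal, abs_of_nonneg hr, div_pow, one_pow, mul_one_div, ← pow_mul]
    gcongr ?_ / ?_ ^ 2
    · exact pow_le_pow_of_le_one hr hr1 (by omega)
    · exact_mod_cast Nat.factorial_le hjm
  have hmain : r ^ (2 * m) * κ' * ‖x‖ ^ 2
      ≤ L * ∑ k ∈ Finset.range (m + 1), Q.reApplyInnerSelf (p k) := by
    calc r ^ (2 * m) * κ' * ‖x‖ ^ 2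
        = r ^ (2 * m) / (m.factorial : ℝ) ^ 2 * (κ * ‖x‖ ^ 2) := by rw [hκ']; ring
      _ ≤ r ^ (2 * m) / (m.factorial : ℝ) ^ 2 *
          ∑ j ∈ Finset.range (m + 1), Q.reApplyInnerSelf ((A ^ j) x) := by
          gcongr
          exact hco x
      _ ≤ ∑ j ∈ Finset.range (m + 1), Q.reApplyInnerSelf ((r : 𝕜) ^ j • y j) := by
          rw [Finset.mul_sum]
          exact Finset.sum_le_sum hlow
      _ ≤ ∑ j ∈ Finset.range (m + 1),
          2 ^ (m + 1) * w * ∑ k ∈ Finset.range (m + 1), Q.reApplyInnerSelf (p k) :=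
          Finset.sum_le_sum hcoef
      _ = _ := by
          rw [Finset.sum_const, Finset.card_range, nsmul_eq_mul, hL]
          push_cast
          ring
  have hsum : ∑ k ∈ Finset.range (m + 1), Q.reApplyInnerSelf (p k)
      ≤ 2 * ∑ k ∈ Finset.range (m + 1), Q.reApplyInnerSelf (flow A ((k + 1) * r) x)
        + (m + 1) * (2 * (‖Q‖ * K₁ ^ 2) * (r ^ (2 * m) * r ^ 2) * ‖x‖ ^ 2) := by
    refine (Finset.sum_le_sum hpu).trans ?_
    rw [Finset.sum_add_distrib, Finset.sum_const, Finset.card_range, nsmul_eq_mul, ← Finset.mul_sum]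
    push_cast
    rfl
  have hX : 0 ≤ r ^ (2 * m) * ‖x‖ ^ 2 := by positivity
  have hfin : (κ' - K₂ * r ^ 2) * (r ^ (2 * m) * ‖x‖ ^ 2) ≤
      2 * L * ∑ k ∈ Finset.range (m + 1), Q.reApplyInnerSelf (flow A ((k + 1) * r) x) := by
    have := hmain.trans (mul_le_mul_of_nonneg_left hsum hL0.le)
    rw [hK₂]
    linarith
  have hfin2 : κ' / 2 * (r ^ (2 * m) * ‖x‖ ^ 2) ≤
      2 * L * ∑ k ∈ Finset.range (m + 1), Q.reApplyInnerSelf (flow A ((k + 1) * r) x) :=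
    (mul_le_mul_of_nonneg_right (by linarith) hX).trans hfin
  rw [show κ' / (4 * L) * r ^ (2 * m) * ‖x‖ ^ 2
    = κ' / 2 * (r ^ (2 * m) * ‖x‖ ^ 2) / (2 * L) by field_simp; ring, div_le_iff₀ (by positivity)]
  linarith

/-- Short-time decay of order `2m + 1`, uniformly over bounded generators with iterated coercivity
of order `m`; the factor `ε` is the weight of `Q` in the Hermitian part of `A`. -/
lemma exists_short_time_decay {Q : H →L[𝕜] H} (hQ : Q.IsPositive) (m : ℕ)
    {b κ : ℝ} (hb : 0 ≤ b) (hκ : 0 < κ) :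
    ∃ c T₀ : ℝ, 0 < c ∧ 0 < T₀ ∧ ∀ (A : H →L[𝕜] H) (ε : ℝ), ‖A‖ ≤ b → 0 ≤ ε →
      (∀ x : H, RCLike.re ⟪A x, x⟫_𝕜 = ε * Q.reApplyInnerSelf x) →
      (∀ x : H, κ * ‖x‖ ^ 2 ≤ ∑ j ∈ Finset.range (m + 1), Q.reApplyInnerSelf ((A ^ j) x)) →
      ∀ (x : H) (t : ℝ), 0 ≤ t → t ≤ T₀ →
        ‖flow A t x‖ ^ 2 ≤ (1 - ε * c * t ^ (2 * m + 1)) * ‖x‖ ^ 2 := by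
  obtain ⟨c, r₀, hc, hr₀, h⟩ := exists_sampled_dissipation_lower_bound hQ m hb hκ
  set n : ℝ := (m : ℝ) + 1 with hn
  have hn0 : 0 < n := by positivity
  refine ⟨2 * c / ((2 * m + 1) * n ^ (2 * m + 2)), n * r₀, by positivity, by positivity,
    fun A ε hA hε hAQ hco x t ht htT => ?_⟩
  have hacc : ∀ x, 0 ≤ RCLike.re ⟪A x, x⟫_𝕜 := fun x => by
    rw [hAQ]; exact mul_nonneg hε (hQ.re_inner_nonneg_left x)
  -- the weighted energy loss at the sampling times, minus its claimed lower bound, is monotone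
  set F : ℝ → ℝ := fun r => (∑ k ∈ Finset.range (m + 1),
    ((k : ℝ) + 1)⁻¹ * (‖x‖ ^ 2 - ‖flow A ((k + 1) * r) x‖ ^ 2))
      - 2 * ε * c * ‖x‖ ^ 2 / (2 * m + 1) * r ^ (2 * m + 1) with hF
  have hF' : ∀ r, HasDerivAt F (2 * ε * ((∑ k ∈ Finset.range (m + 1),
      Q.reApplyInnerSelf (flow A ((k + 1) * r) x)) - c * r ^ (2 * m) * ‖x‖ ^ 2)) r := by
    intro r
    have h1 : ∀ k ∈ Finset.range (m + 1), HasDerivAt (fun r : ℝ =>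
        ((k : ℝ) + 1)⁻¹ * (‖x‖ ^ 2 - ‖flow A ((k + 1) * r) x‖ ^ 2))
        (2 * ε * Q.reApplyInnerSelf (flow A ((k + 1) * r) x)) r := by
      intro k _
      have e1 := (hasDerivAt_norm_sq_flow A x ((k + 1) * r)).comp r
        ((hasDerivAt_id r).const_mul ((k : ℝ) + 1))
      have e2 := (e1.const_sub (‖x‖ ^ 2)).const_mul ((k : ℝ) + 1)⁻¹
      have hk : (k : ℝ) + 1 ≠ 0 := by positivity
      refine HasDerivAt.congr_deriv e2 ?_
      rw [hAQ]
      field_simp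
    have h2 : HasDerivAt (fun r : ℝ => 2 * ε * c * ‖x‖ ^ 2 / (2 * m + 1) * r ^ (2 * m + 1))
        (2 * ε * c * ‖x‖ ^ 2 * r ^ (2 * m)) r := by
      have e := (hasDerivAt_pow (2 * m + 1) r).const_mul (2 * ε * c * ‖x‖ ^ 2 / (2 * m + 1))
      refine e.congr_deriv ?_
      have : (2 * (m : ℝ) + 1) ≠ 0 := by positivity
      push_cast
      field_simp
    refine ((HasDerivAt.fun_sum h1).sub h2).congr_deriv ?_
    rw [← Finset.mul_sum]
    ring
  have hmono : MonotoneOn F (Set.Icc 0 r₀) := by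
    refine monotoneOn_of_hasDerivWithinAt_nonneg (convex_Icc _ _)
      (fun r _ => (hF' r).continuousAt.continuousWithinAt)
      (fun r _ => (hF' r).hasDerivWithinAt) fun r hr => ?_
    rw [interior_Icc] at hr
    have := h A hA hco x r hr.1.le hr.2.le
    exact mul_nonneg (by positivity) (by linarith)
  set r : ℝ := t / n with hr
  have hr0 : 0 ≤ r := by positivity
  have hrr : r ≤ r₀ := by rw [hr, div_le_iff₀ hn0]; linarith
  have hFr : 0 ≤ F r := by
    have h1 := hmono ⟨le_rfl, hr₀.le⟩ ⟨hr0, hrr⟩ hr0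
    have h2 : F 0 = 0 := by simp [hF]
    linarith
  have hsum : ∑ k ∈ Finset.range (m + 1),
      ((k : ℝ) + 1)⁻¹ * (‖x‖ ^ 2 - ‖flow A ((k + 1) * r) x‖ ^ 2)
        ≤ n * (‖x‖ ^ 2 - ‖flow A t x‖ ^ 2) := by
    have : ∀ k ∈ Finset.range (m + 1),
        ((k : ℝ) + 1)⁻¹ * (‖x‖ ^ 2 - ‖flow A ((k + 1) * r) x‖ ^ 2)
          ≤ ‖x‖ ^ 2 - ‖flow A t x‖ ^ 2 := by
      intro k hk
      have hkm : (k : ℝ) ≤ m := by exact_mod_cast Nat.lt_succ_iff.mp (Finset.mem_range.mp hk)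
      have hkt : ((k : ℝ) + 1) * r ≤ t := by
        rw [hr, mul_div_assoc', div_le_iff₀ hn0, mul_comm]
        gcongr
        linarith
      have e1 := norm_sq_flow_antitone hacc x hkt
      have e2 := norm_sq_flow_antitone hacc x ht
      simp only [flow_zero, one_apply_eq_self] at e1 e2
      have e3 : ((k : ℝ) + 1)⁻¹ ≤ 1 := inv_le_one_of_one_le₀ (by linarith [k.cast_nonneg (α := ℝ)])
      have e4 : 0 ≤ ((k : ℝ) + 1)⁻¹ := by positivity
      calc _ ≤ ((k : ℝ) + 1)⁻¹ * (‖x‖ ^ 2 - ‖flow A t x‖ ^ 2) := by gcongr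
        _ ≤ _ := mul_le_of_le_one_left (by linarith) e3
    refine (Finset.sum_le_sum this).trans_eq ?_
    rw [Finset.sum_const, Finset.card_range, nsmul_eq_mul, hn]
    push_cast
    rfl
  have hfin : 2 * ε * c * ‖x‖ ^ 2 / (2 * m + 1) * r ^ (2 * m + 1)
      ≤ n * (‖x‖ ^ 2 - ‖flow A t x‖ ^ 2) := by
    simp only [hF] at hFr
    linarith
  have hval : 2 * ε * c * ‖x‖ ^ 2 / (2 * m + 1) * r ^ (2 * m + 1)
      = n * (ε * (2 * c / ((2 * m + 1) * n ^ (2 * m + 2))) * t ^ (2 * m + 1) * ‖x‖ ^ 2) := by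
    rw [hr, div_pow, pow_succ n (2 * m + 1)]
    field_simp
  rw [hval] at hfin
  have := le_of_mul_le_mul_left hfin hn0
  linarith

/-- If the iterated dissipation of order below `m` can be made arbitrarily small, then the orbits
lose at most `O(t^(2m+1))` of their energy, so a bound on all orbits cannot be better. -/
lemma exists_short_time_lower_bound {Q A : H →L[𝕜] H} (hQ : Q.IsPositive) (m : ℕ)
    (hAQ : ∀ x : H, RCLike.re ⟪A x, x⟫_𝕜 = Q.reApplyInnerSelf x)
    (hsmall : ∀ ε : ℝ, 0 < ε → ∃ x : H, x ≠ 0 ∧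
      ∑ j ∈ Finset.range m, Q.reApplyInnerSelf ((A ^ j) x) ≤ ε * ‖x‖ ^ 2) :
    ∃ c : ℝ, 0 < c ∧ ∀ t K : ℝ, 0 ≤ t → t ≤ 1 → (∀ x : H, ‖flow A t x‖ ^ 2 ≤ K * ‖x‖ ^ 2) →
      1 - c * t ^ (2 * m + 1) ≤ K := by
  have hq0 : ∀ y, 0 ≤ Q.reApplyInnerSelf y := hQ.re_inner_nonneg_left
  set K₁ : ℝ := ‖A‖ ^ m * Real.exp ‖A‖ with hK₁
  set K₂ : ℝ := 2 * (‖Q‖ * K₁ ^ 2) + 1 with hK₂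
  have hK₂0 : 0 < K₂ := by positivity
  refine ⟨2 * K₂, by positivity, fun t K ht ht1 hK => le_of_forall_pos_sub_le fun δ hδ => ?_⟩
  obtain ⟨x, hx, hxs⟩ := hsmall (δ / (4 * 2 ^ m)) (by positivity)
  have hx2 : 0 < ‖x‖ ^ 2 := by positivity
  -- along the orbit the dissipation is at most `O(s^(2m))`, up to a small constant
  have hdiss : ∀ s, 0 ≤ s → s ≤ t → Q.reApplyInnerSelf (flow A s x)
      ≤ (δ / 2 + K₂ * t ^ (2 * m)) * ‖x‖ ^ 2 := by
    intro s hs hst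
    have hs1 := hst.trans ht1
    have hT := norm_flow_sub_taylor_le A hs le_rfl m x
    set p := ∑ j ∈ Finset.range m, (s : 𝕜) ^ j • (((-1) ^ j / (j.factorial : 𝕜)) • (A ^ j) x)
    have h1 := reApplyInnerSelf_add_le hQ p (flow A s x - p)
    rw [add_sub_cancel] at h1
    have hp : Q.reApplyInnerSelf p ≤ 2 ^ m * (δ / (4 * 2 ^ m) * ‖x‖ ^ 2) := by
      refine (reApplyInnerSelf_sum_range_le hQ _ _).trans ?_
      gcongr
      refine le_trans (Finset.sum_le_sum fun j _ => ?_) hxs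
      rw [reApplyInnerSelf_smul, reApplyInnerSelf_smul, ← mul_assoc]
      refine mul_le_of_le_one_left (hq0 _) ?_
      rw [norm_div, norm_pow, norm_pow, norm_neg, norm_one, one_pow, RCLike.norm_natCast,
        RCLike.norm_ofReal, abs_of_nonneg hs, ← mul_pow]
      refine pow_le_one₀ (by positivity) (mul_le_one₀ (pow_le_one₀ hs hs1) (by positivity) ?_)
      rw [one_div]
      exact inv_le_one_of_one_le₀ (by exact_mod_cast Nat.factorial_pos j)
    have hr : ‖flow A s x - p‖ ≤ K₁ * t ^ m * ‖x‖ := by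
      refine hT.trans ?_
      calc (s * ‖A‖) ^ m * Real.exp (s * ‖A‖) * ‖x‖
          ≤ (t * ‖A‖) ^ m * Real.exp ‖A‖ * ‖x‖ := by
            gcongr
            exact mul_le_of_le_one_left (norm_nonneg _) hs1
        _ = _ := by rw [hK₁]; ring
    have hr2 : Q.reApplyInnerSelf (flow A s x - p) ≤ ‖Q‖ * (K₁ * t ^ m * ‖x‖) ^ 2 :=
      (reApplyInnerSelf_le _).trans (by gcongr)
    have hp' : (2 : ℝ) ^ m * (δ / (4 * 2 ^ m) * ‖x‖ ^ 2) = δ / 4 * ‖x‖ ^ 2 := by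
      field_simp
    have e : ‖Q‖ * (K₁ * t ^ m * ‖x‖) ^ 2 = ‖Q‖ * K₁ ^ 2 * t ^ (2 * m) * ‖x‖ ^ 2 := by ring
    have e2 : 0 ≤ t ^ (2 * m) * ‖x‖ ^ 2 := by positivity
    rw [hp'] at hp
    rw [e] at hr2
    rw [hK₂]
    linarith
  set D : ℝ := 2 * ((δ / 2 + K₂ * t ^ (2 * m)) * ‖x‖ ^ 2) with hD
  have hmono : MonotoneOn (fun s => ‖flow A s x‖ ^ 2 + D * s) (Set.Icc 0 t) := by
    have hd : ∀ s, HasDerivAt (fun s => ‖flow A s x‖ ^ 2 + D * s)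
        (-2 * Q.reApplyInnerSelf (flow A s x) + D) s := fun s => by
      have := (hasDerivAt_norm_sq_flow A x s).add ((hasDerivAt_id s).const_mul D)
      rw [hAQ, mul_one] at this
      exact this
    refine monotoneOn_of_hasDerivWithinAt_nonneg (convex_Icc _ _)
      (fun s _ => (hd s).continuousAt.continuousWithinAt)
      (fun s _ => (hd s).hasDerivWithinAt) fun s hs => ?_
    rw [interior_Icc] at hs
    linarith [hdiss s hs.1.le hs.2.le]
  have h1 := hmono ⟨le_rfl, ht⟩ ⟨ht, le_rfl⟩ ht
  simp only [flow_zero, one_apply_eq_self, mul_zero, add_zero] at h1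
  have h2 := h1.trans (add_le_add_left (hK x) (D * t))
  have h3 : ‖x‖ ^ 2 * 1 ≤ ‖x‖ ^ 2 * (K + δ * t + 2 * K₂ * t ^ (2 * m + 1)) := by
    rw [hD] at h2
    calc _ = ‖x‖ ^ 2 := mul_one _
      _ ≤ _ := h2
      _ = _ := by ring
  have h4 := le_of_mul_le_mul_left h3 hx2
  nlinarith

end

/-! ### Estimates for single modes -/

section

variable {𝕜 : Type*} [RCLike 𝕜] {H : Type*} [NormedAddCommGroup H] [InnerProductSpace 𝕜 H]
  [CompleteSpace H]

/-- Iteration of a decay estimate over one time step `h`. -/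
lemma norm_sq_flow_le_exp_floor {A : H →L[𝕜] H} (hA : ∀ x, 0 ≤ RCLike.re ⟪A x, x⟫_𝕜) {h s : ℝ}
    (hh : 0 < h) (hstep : ∀ x : H, ‖flow A h x‖ ^ 2 ≤ Real.exp (-s) * ‖x‖ ^ 2) {t : ℝ}
    (ht : 0 ≤ t) (x : H) :
    ‖flow A t x‖ ^ 2 ≤ Real.exp (-(⌊t / h⌋₊ * s)) * ‖x‖ ^ 2 := by
  have hn : ∀ n : ℕ, ‖flow A (n * h) x‖ ^ 2 ≤ Real.exp (-(n * s)) * ‖x‖ ^ 2 := by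
    intro n
    induction n with
    | zero => simp
    | succ n ih =>
      have e1 : ((n + 1 : ℕ) : ℝ) * h = h + n * h := by push_cast; ring
      have e2 : -(((n + 1 : ℕ) : ℝ) * s) = -s + -(n * s) := by push_cast; ring
      rw [e1, e2, flow_add, mul_apply_eq_comp, Real.exp_add, mul_assoc]
      exact (hstep _).trans (by gcongr)
  have hle : (⌊t / h⌋₊ : ℝ) * h ≤ t := by
    rw [← le_div_iff₀ hh]
    exact Nat.floor_le (by positivity)
  exact (norm_sq_flow_antitone hA x hle).trans (hn _)

lemma exp_neg_le_one_sub_half {y : ℝ} (h0 : 0 ≤ y) (h1 : y ≤ 1) : Real.exp (-y) ≤ 1 - y / 2 := by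
  rw [Real.exp_neg, inv_le_comm₀ (Real.exp_pos y) (by linarith)]
  refine le_trans ?_ (Real.add_one_le_exp y)
  rw [inv_le_iff_one_le_mul₀ (by linarith)]
  nlinarith

/-- Short-time decay of order `2m + 1`, uniformly over all frequencies `|η| ≥ 1`. In the rescaled
time `|η| t` the mode is generated by an operator from a bounded set; for bounded rescaled times
the rescaling only improves the estimate, and for large ones iteration gives exponential decay. -/
lemma exists_modeOp_decay {C : H →L[𝕜] H} {m : ℕ} (hC : IsAccretive C)
    (hm : HypocoercivityBound C m) :
    ∃ c τ : ℝ, 0 < c ∧ 0 < τ ∧ ∀ η : ℝ, 1 ≤ |η| → ∀ (x : H) (t : ℝ), 0 ≤ t → t ≤ τ →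
      ‖flow (modeOp C η) t x‖ ^ 2 ≤ (1 - c * t ^ (2 * m + 1)) * ‖x‖ ^ 2 := by
  obtain ⟨κ, hκ, hco⟩ := hm.exists_uniform hC
  obtain ⟨c, T₀, hc, hT₀, hdec⟩ := exists_short_time_decay hC.isPositive m
    (b := ‖skewPart C‖ + ‖hermPart C‖) (by positivity) hκ
  -- the rate of exponential decay at rescaled times beyond `T₀`
  set d : ℝ := c * T₀ ^ (2 * m) / 2 with hd
  have hd0 : 0 < d := by positivity
  refine ⟨min c (d / 2), min 1 d⁻¹, by positivity, by positivity, fun η hη x t ht htτ => ?_⟩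
  have hη0 : 0 < |η| := zero_lt_one.trans_le hη
  have ht1 : t ≤ 1 := htτ.trans (min_le_left _ _)
  have htd : d * t ≤ 1 := by
    have := htτ.trans (min_le_right _ _)
    rwa [← one_div, le_div_iff₀ hd0, mul_comm] at this
  set A : H →L[𝕜] H := ((|η|⁻¹ : ℝ) : 𝕜) • modeOp C η with hA
  have hflow : ∀ s, flow (modeOp C η) s = flow A (|η| * s) := by
    intro s
    rw [← flow_real_smul, hA, smul_smul, ← RCLike.ofReal_mul, mul_inv_cancel₀ hη0.ne',
      RCLike.ofReal_one, one_smul]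
  have hAB : ∀ j y, (hermPart C).reApplyInnerSelf ((A ^ j) y)
      = (hermPart C).reApplyInnerSelf ((scaledMode C η ^ j) y) := by
    intro j y
    rw [scaledMode, hA, smul_pow, smul_pow, smul_apply, smul_apply, reApplyInnerSelf_smul,
      reApplyInnerSelf_smul, norm_pow, norm_pow, RCLike.norm_ofReal, RCLike.norm_ofReal, abs_inv,
      abs_inv, abs_abs]
  have hAn : ‖A‖ ≤ ‖skewPart C‖ + ‖hermPart C‖ := by
    refine le_trans (le_of_eq ?_) (norm_scaledMode_le C hη)
    rw [scaledMode, hA, norm_smul, norm_smul, RCLike.norm_ofReal, RCLike.norm_ofReal, abs_inv,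
      abs_inv, abs_abs]
  have hAQ : ∀ y, RCLike.re ⟪A y, y⟫_𝕜 = |η|⁻¹ * (hermPart C).reApplyInnerSelf y := by
    intro y
    rw [hA, smul_apply, inner_smul_left, RCLike.conj_ofReal, RCLike.re_ofReal_mul,
      re_inner_modeOp]
  have hstep := hdec A |η|⁻¹ hAn (by positivity) hAQ (fun y => by simpa only [hAB] using hco η hη y)
  rcases le_or_gt (|η| * t) T₀ with hcase | hcase
  · rw [hflow]
    refine (hstep x _ (by positivity) hcase).trans ?_
    gcongr ?_ * _
    have h1 : |η|⁻¹ * c * (|η| * t) ^ (2 * m + 1) = c * (|η| ^ (2 * m) * t ^ (2 * m + 1)) := by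
      rw [mul_pow, pow_succ |η|]
      field_simp
    have h2 : t ^ (2 * m + 1) ≤ |η| ^ (2 * m) * t ^ (2 * m + 1) :=
      le_mul_of_one_le_left (by positivity) (one_le_pow₀ hη)
    have h3 : min c (d / 2) * t ^ (2 * m + 1) ≤ c * (|η| ^ (2 * m) * t ^ (2 * m + 1)) := by
      gcongr
      exact min_le_left _ _
    linarith
  · set h : ℝ := T₀ / |η| with hh
    have hh0 : 0 < h := by positivity
    set s : ℝ := |η|⁻¹ * c * T₀ ^ (2 * m + 1) with hs
    have hs0 : 0 < s := by positivity
    have hone : ∀ y : H, ‖flow (modeOp C η) h y‖ ^ 2 ≤ Real.exp (-s) * ‖y‖ ^ 2 := by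
      intro y
      rw [hflow, hh, mul_div_cancel₀ _ hη0.ne']
      refine (hstep y T₀ hT₀.le le_rfl).trans ?_
      gcongr
      have := Real.add_one_le_exp (-s)
      linarith
    refine (norm_sq_flow_le_exp_floor (re_inner_modeOp_nonneg hC η) hh0 hone ht x).trans ?_
    gcongr ?_ * _
    have hth : 1 ≤ t / h := by
      rw [hh, le_div_iff₀ hh0, one_mul, div_le_iff₀ hη0]
      linarith
    -- at least half of `t / h` full steps fit into the time `t`
    have hfl : t / h / 2 ≤ ⌊t / h⌋₊ := by
      have h1 : (1 : ℝ) ≤ ⌊t / h⌋₊ := by exact_mod_cast Nat.one_le_floor_iff _ |>.mpr hth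
      have h2 := Nat.lt_floor_add_one (t / h)
      linarith
    have hds : d * t = t / h / 2 * s := by
      rw [hd, hs, hh, pow_succ]
      field_simp
    have hexp : Real.exp (-(⌊t / h⌋₊ * s)) ≤ Real.exp (-(d * t)) := by
      rw [hds]
      gcongr
    refine hexp.trans ((exp_neg_le_one_sub_half (by positivity) htd).trans ?_)
    have h1 : t ^ (2 * m + 1) ≤ t := pow_le_of_le_one ht ht1 (by omega)
    have h2 : min c (d / 2) * t ^ (2 * m + 1) ≤ d / 2 * t := by
      gcongr
      exact min_le_right _ _
    linarith

/-- Minimality of the hypocoercivity index: at a single frequency, the iterated dissipation of order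
below the index is not bounded below. -/
lemma IsHypocoerciveWithIndex.exists_small_dissipation [Nontrivial H] {C : H →L[𝕜] H} {m : ℕ}
    (hC : IsHypocoerciveWithIndex C m) {η : ℝ} (hη : 1 ≤ |η|) {ε : ℝ} (hε : 0 < ε) :
    ∃ x : H, x ≠ 0 ∧ ∑ j ∈ Finset.range m,
      (hermPart C).reApplyInnerSelf ((modeOp C η ^ j) x) ≤ ε * ‖x‖ ^ 2 := by
  obtain _ | m := m
  · obtain ⟨x, hx⟩ := exists_ne (0 : H)
    exact ⟨x, hx, by simpa using by positivity⟩
  by_contra! hcon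
  have hη0 : 0 < |η| := zero_lt_one.trans_le hη
  suffices hb : HypocoercivityBound C m from absurd (hC.isLeast.2 hb) (by omega)
  refine HypocoercivityBound.of_scaledMode hC.accretive hη
    (κ := (|η| ^ (2 * m))⁻¹ * ε) (by positivity) fun x => ?_
  rcases eq_or_ne x 0 with rfl | hx
  · simp [ContinuousLinearMap.reApplyInnerSelf_apply]
  rw [mul_assoc]
  refine (mul_le_mul_of_nonneg_left (hcon x hx).le (by positivity)).trans ?_
  rw [Finset.mul_sum]
  refine Finset.sum_le_sum fun j hj => ?_
  rw [scaledMode_pow_apply, reApplyInnerSelf_smul, RCLike.norm_ofReal, abs_inv, abs_pow, inv_pow,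
    ← pow_mul]
  refine mul_le_mul_of_nonneg_right ?_ (hC.accretive.isPositive.re_inner_nonneg_left _)
  have hjm := Finset.mem_range.mp hj
  exact inv_anti₀ (by positivity) (pow_le_pow_right₀ hη (by omega))

lemma lyapunovMode_eq (C : H →L[𝕜] H) (m : ℕ) (η : ℝ) :
    lyapunovMode C m η = ∑ j ∈ Finset.range (m + 1),
      ContinuousLinearMap.adjoint (scaledMode C η ^ j) * scaledMode C η ^ j := by
  refine Finset.sum_congr rfl fun j _ => ?_
  have h : ContinuousLinearMap.adjoint (modeOp C η) ^ j
      = ContinuousLinearMap.adjoint (modeOp C η ^ j) := by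
    rw [← ContinuousLinearMap.star_eq_adjoint, ← ContinuousLinearMap.star_eq_adjoint, star_pow]
  rw [scaledMode, smul_pow, ← RCLike.ofReal_pow, map_smulₛₗ, RCLike.conj_ofReal,
    smul_mul_smul_comm, ← RCLike.ofReal_mul, h, inv_pow, ← mul_inv, ← pow_add, two_mul]

lemma norm_lyapunovMode_le (C : H →L[𝕜] H) (m : ℕ) {η : ℝ} (hη : 1 ≤ |η|) :
    ‖lyapunovMode C m η‖ ≤
      ∑ j ∈ Finset.range (m + 1), ((1 + (‖skewPart C‖ + ‖hermPart C‖)) ^ j) ^ 2 := by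
  rw [lyapunovMode_eq]
  refine norm_sum_le_of_le _ fun j _ => ?_
  have hj : ‖scaledMode C η ^ j‖ ≤ (1 + (‖skewPart C‖ + ‖hermPart C‖)) ^ j := by
    rcases Nat.eq_zero_or_pos j with rfl | hj
    · rw [pow_zero, pow_zero]; exact ContinuousLinearMap.norm_id_le
    · refine (norm_pow_le' _ hj).trans ?_
      gcongr
      linarith [norm_scaledMode_le C hη]
  refine (norm_mul_le _ _).trans ?_
  rw [LinearIsometryEquiv.norm_map, ← sq]
  gcongr

lemma isSelfAdjoint_lyapunovMode (C : H →L[𝕜] H) (m : ℕ) (η : ℝ) :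
    IsSelfAdjoint (lyapunovMode C m η) := by
  rw [lyapunovMode_eq]
  exact isSelfAdjoint_sum _ fun j _ => IsSelfAdjoint.star_mul_self (scaledMode C η ^ j)

lemma norm_sq_le_re_inner_lyapunovMode (C : H →L[𝕜] H) (m : ℕ) (η : ℝ) (x : H) :
    ‖x‖ ^ 2 ≤ RCLike.re ⟪lyapunovMode C m η x, x⟫_𝕜 := by
  have hterm : ∀ j, RCLike.re ⟪(ContinuousLinearMap.adjoint (scaledMode C η ^ j) *
      scaledMode C η ^ j) x, x⟫_𝕜 = ‖(scaledMode C η ^ j) x‖ ^ 2 := fun j => by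
    rw [mul_apply_eq_comp, ContinuousLinearMap.adjoint_inner_left, inner_self_eq_norm_sq]
  rw [lyapunovMode_eq, sum_apply, sum_inner, map_sum, Finset.sum_congr rfl fun j _ => hterm j]
  have := Finset.single_le_sum (f := fun j => ‖(scaledMode C η ^ j) x‖ ^ 2)
    (fun _ _ => by positivity) (Finset.mem_range.mpr (Nat.succ_pos m))
  simpa using this

/-- The Lyapunov operator turns the dissipation of a mode into its iterated dissipation, because
`C_η` commutes with its powers. -/
lemma re_inner_modeOp_lyapunovMode (C : H →L[𝕜] H) (m : ℕ) (η : ℝ) (x : H) :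
    RCLike.re ⟪modeOp C η x, lyapunovMode C m η x⟫_𝕜 =
      ∑ j ∈ Finset.range (m + 1), (hermPart C).reApplyInnerSelf ((scaledMode C η ^ j) x) := by
  rw [lyapunovMode_eq, sum_apply, inner_sum, map_sum]
  refine Finset.sum_congr rfl fun j _ => ?_
  have hcomm : Commute (scaledMode C η ^ j) (modeOp C η) :=
    ((Commute.refl (modeOp C η)).smul_left _).pow_left j
  have h : (scaledMode C η ^ j) (modeOp C η x) = modeOp C η ((scaledMode C η ^ j) x) :=
    DFunLike.congr_fun hcomm.eq x
  rw [mul_apply_eq_comp, ContinuousLinearMap.adjoint_inner_right, h, re_inner_modeOp]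

end

/-! ### The semigroup on the Hilbert sum -/

section

variable {𝕜 : Type*} [RCLike 𝕜]

section Diagonal

variable {H : Type*} [NormedAddCommGroup H] {ι : Type*}

lemma hasSum_norm_sq (x : lp (fun _ : ι => H) 2) : HasSum (fun i => ‖x i‖ ^ 2) (‖x‖ ^ 2) := by
  have := lp.hasSum_norm (p := 2) (by norm_num) x
  simpa using this

lemma memℓp_two_of_norm_le {f : ι → H} {b : ℝ} (x : lp (fun _ : ι => H) 2)
    (h : ∀ i, ‖f i‖ ≤ b * ‖x i‖) : Memℓp f 2 := by
  refine memℓp_gen ?_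
  simp only [ENNReal.toReal_ofNat, Real.rpow_ofNat]
  refine Summable.of_nonneg_of_le (fun i => by positivity) (fun i => ?_)
    ((hasSum_norm_sq x).summable.mul_left (b ^ 2))
  rw [← mul_pow]
  exact pow_le_pow_left₀ (norm_nonneg _) (h i) 2

lemma norm_sq_le_of_forall_norm_sq_le {x y : lp (fun _ : ι => H) 2} {K : ℝ}
    (h : ∀ i, ‖y i‖ ^ 2 ≤ K * ‖x i‖ ^ 2) : ‖y‖ ^ 2 ≤ K * ‖x‖ ^ 2 :=
  hasSum_le h (hasSum_norm_sq y) ((hasSum_norm_sq x).mul_left K)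

/-- Dominated convergence in the Hilbert sum: coordinatewise convergence suffices if the
coordinates are dominated by those of a fixed element. -/
lemma tendsto_lp_of_dominated {α : Type*} {l : Filter α} {f : α → lp (fun _ : ι => H) 2}
    {g x : lp (fun _ : ι => H) 2} (b : ℝ) (hdom : ∀ᶠ a in l, ∀ i, ‖f a i - g i‖ ≤ b * ‖x i‖)
    (hlim : ∀ i, Tendsto (fun a => f a i) l (𝓝 (g i))) : Tendsto f l (𝓝 g) := by
  have h := tendsto_tsum_of_dominated_convergence (𝓕 := l) (f := fun a i => ‖f a i - g i‖ ^ 2)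
    (g := fun _ => (0 : ℝ)) (bound := fun i => b ^ 2 * ‖x i‖ ^ 2)
    ((hasSum_norm_sq x).summable.mul_left (b ^ 2))
    (fun i => by
      have := (((hlim i).sub_const (g i)).norm).pow 2
      simpa using this)
    (hdom.mono fun a ha i => by
      rw [Real.norm_of_nonneg (by positivity), ← mul_pow]
      exact pow_le_pow_left₀ (norm_nonneg _) (ha i) 2)
  have h2 : ∀ a, ∑' i, ‖f a i - g i‖ ^ 2 = ‖f a - g‖ ^ 2 := fun a =>
    (hasSum_norm_sq (f a - g)).tsum_eq
  simp only [h2, tsum_zero] at h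
  rw [tendsto_iff_norm_sub_tendsto_zero]
  have h3 := (Real.continuous_sqrt.tendsto 0).comp h
  simpa [Function.comp_def] using h3

variable [NormedSpace 𝕜 H]

/-- The diagonal operator on the Hilbert sum with uniformly bounded entries `A i`. -/
def diagonal (A : ι → H →L[𝕜] H) (b : ℝ) (hA : ∀ i x, ‖A i x‖ ≤ b * ‖x‖) :
    lp (fun _ : ι => H) 2 →L[𝕜] lp (fun _ : ι => H) 2 :=
  LinearMap.mkContinuous
    { toFun := fun x => ⟨fun i => A i (x i), memℓp_two_of_norm_le x fun i => hA i (x i)⟩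
      map_add' := fun x y => lp.ext (funext fun i => map_add (A i) (x i) (y i))
      map_smul' := fun c x => lp.ext (funext fun i => map_smul (A i) c (x i)) }
    |b| fun x => by
      refine (sq_le_sq₀ (norm_nonneg _) (by positivity)).mp ?_
      rw [mul_pow]
      refine norm_sq_le_of_forall_norm_sq_le fun i => ?_
      rw [← mul_pow]
      exact pow_le_pow_left₀ (norm_nonneg _) ((hA i (x i)).trans (by gcongr; exact le_abs_self b)) 2

@[simp]
lemma diagonal_apply (A : ι → H →L[𝕜] H) (b : ℝ) (hA : ∀ i x, ‖A i x‖ ≤ b * ‖x‖)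
    (x : lp (fun _ : ι => H) 2) (i : ι) : diagonal A b hA x i = A i (x i) :=
  rfl

end Diagonal

section Uniqueness

variable {X : Type*} [NormedAddCommGroup X] [NormedSpace 𝕜 X]

lemma C0Semigroup.eq_of_op_eq {T T' : C0Semigroup 𝕜 X} (h : ∀ t, T.op t = T'.op t) : T = T' := by
  cases T
  cases T'
  congr
  exact funext h

lemma C0Semigroup.exists_norm_op_le [CompleteSpace X] (T : C0Semigroup 𝕜 X) (t : ℝ≥0) :
    ∃ M : ℝ, ∀ s ≤ t, ‖T.op s‖ ≤ M := by
  obtain ⟨M, hM⟩ := banach_steinhaus (g := fun s : Set.Icc (0 : ℝ≥0) t => T.op s) fun x => by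
    obtain ⟨M, hM⟩ := (isCompact_Icc (a := (0 : ℝ≥0)) (b := t)).exists_bound_of_continuousOn
      (T.continuous_orbit x).continuousOn
    exact ⟨M, fun s => hM s s.2⟩
  exact ⟨M, fun s hs => hM ⟨s, zero_le, hs⟩⟩

/-- A strongly continuous semigroup is jointly continuous in time and state. -/
lemma C0Semigroup.tendsto_op_apply [CompleteSpace X] (T : C0Semigroup 𝕜 X) {α : Type*}
    {l : Filter α} {s : α → ℝ≥0} {y : α → X} {s₀ : ℝ≥0} {y₀ : X} (hs : Tendsto s l (𝓝 s₀))
    (hy : Tendsto y l (𝓝 y₀)) : Tendsto (fun a => T.op (s a) (y a)) l (𝓝 (T.op s₀ y₀)) := by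
  obtain ⟨M, hM⟩ := T.exists_norm_op_le (s₀ + 1)
  have h1 : Tendsto (fun a => T.op (s a) (y a - y₀)) l (𝓝 0) := by
    have hlim : Tendsto (fun a => M * ‖y a - y₀‖) l (𝓝 0) := by
      simpa using ((hy.sub_const y₀).norm).const_mul M
    refine squeeze_zero_norm' ?_ hlim
    filter_upwards [hs.eventually (gt_mem_nhds (lt_add_one s₀))] with a ha
    exact (T.op (s a)).le_of_opNorm_le (hM _ ha.le) _
  have h2 := ((T.continuous_orbit y₀).tendsto s₀).comp hs
  have h3 := h1.add h2
  simp only [zero_add] at h3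
  refine h3.congr fun a => ?_
  simp

end Uniqueness

variable {H : Type*} [NormedAddCommGroup H] [InnerProductSpace 𝕜 H] [CompleteSpace H]

/-- Difference quotients of an orbit in reversed time. -/
lemma tendsto_flow_slope_reverse (A : H →L[𝕜] H) (x : H) (r : ℝ) :
    Tendsto (fun t : ℝ => ((t : 𝕜))⁻¹ • (flow A (r - t) x - flow A r x)) (𝓝[>] 0)
      (𝓝 (A (flow A r x))) := by
  let : InnerProductSpace ℝ H := InnerProductSpace.rclikeToReal 𝕜 H
  have : IsScalarTower ℝ 𝕜 H := inferInstance
  have h0 : HasDerivAt (fun t : ℝ => flow A (r - t) x) (A (flow A r x)) 0 := by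
    have h1 : HasDerivAt (fun s : ℝ => flow A s x) (-(A (flow A (r - 0) x))) (r - 0) :=
      hasDerivAt_flow_apply A x _
    have h2 := HasDerivAt.scomp (0 : ℝ) h1 ((hasDerivAt_id (0 : ℝ)).const_sub r)
    refine HasDerivAt.congr_deriv h2 ?_
    simp
  have h := h0.tendsto_slope_zero_right
  simp only [zero_add, sub_zero] at h
  refine h.congr fun t => ?_
  rw [← RCLike.ofReal_inv, RCLike.real_smul_eq_coe_smul (K := 𝕜)]

section ModalSemigroup

variable {C : H →L[𝕜] H} {E : Set ℝ}

/-- The semigroup `T_E(t) (x_η)_η = (exp(-t C_η) x_η)_η` on the Hilbert sum of the modes. -/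
def modalSemigroup (hC : IsAccretive C) (E : Set ℝ) : C0Semigroup 𝕜 (ModalSpace H E) where
  op t := diagonal (fun η : E => flow (modeOp C η) t) 1 fun η x => by
    rw [one_mul]
    exact norm_flow_apply_le (re_inner_modeOp_nonneg hC η) t.2 x
  op_zero := by
    ext x η
    simp
  op_add s t := by
    ext x η
    rw [diagonal_apply, NNReal.coe_add, flow_add]
    rfl
  continuous_orbit x := by
    refine continuous_iff_continuousAt.mpr fun s => ?_
    refine tendsto_lp_of_dominated (x := x) 2 (.of_forall fun t η => ?_) fun η => ?_
    · have hc := fun r : ℝ≥0 => norm_flow_apply_le (re_inner_modeOp_nonneg hC η) r.2 (x η)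
      refine (norm_sub_le _ _).trans ?_
      exact (add_le_add (hc t) (hc s)).trans_eq (two_mul _).symm
    · exact ((continuous_flow_apply (modeOp C η) (x η)).comp NNReal.continuous_coe).tendsto s

lemma mem_graph_neg_modalOp {x y : ModalSpace H E} :
    (x, y) ∈ (-modalOp C E).graph ↔ ∀ η : E, y η = -(modeOp C (η : ℝ) (x η)) := by
  rw [LinearPMap.mem_graph_iff]
  constructor
  · rintro ⟨z, rfl, hz⟩ η
    simp only at hz
    rw [← hz]
    rfl
  · intro h
    have hx : x ∈ (modalOp C E).domain := by
      refine memℓp_two_of_norm_le (b := 1) y fun η => ?_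
      rw [h η, norm_neg, one_mul]
    refine ⟨⟨x, hx⟩, rfl, lp.ext (funext fun η => ?_)⟩
    rw [h η]
    rfl

lemma tendsto_coe_nhdsGT_zero : Tendsto ((↑) : ℝ≥0 → ℝ) (𝓝[>] 0) (𝓝[>] 0) := by
  refine tendsto_nhdsWithin_iff.mpr ⟨?_, ?_⟩
  · exact (NNReal.continuous_coe.tendsto 0).mono_left nhdsWithin_le_nhds
  · filter_upwards [self_mem_nhdsWithin] with t ht
    exact NNReal.coe_pos.mpr ht

lemma hasGenerator_modalSemigroup (hC : IsAccretive C) (E : Set ℝ) :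
    (modalSemigroup hC E).HasGenerator (-modalOp C E) := by
  intro x y
  have hslope : ∀ η : E, Tendsto (fun t : ℝ≥0 => ((((t : ℝ) : 𝕜))⁻¹ •
      ((modalSemigroup hC E).op t x - x)) η) (𝓝[>] 0) (𝓝 (-(modeOp C (η : ℝ) (x η)))) := fun η =>
    (tendsto_flow_slope (modeOp C (η : ℝ)) (x η)).comp tendsto_coe_nhdsGT_zero
  rw [mem_graph_neg_modalOp]
  constructor
  · intro h
    -- the difference quotients are dominated by the coordinates of `C_E x`
    refine tendsto_lp_of_dominated (x := y) 2 ?_ fun η => by rw [h η]; exact hslope η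
    filter_upwards [self_mem_nhdsWithin] with t ht η
    have ht' : 0 < (t : ℝ) := NNReal.coe_pos.mpr ht
    have hb : ‖(((t : ℝ) : 𝕜))⁻¹ • (flow (modeOp C (η : ℝ)) t (x η) - x η)‖ ≤ ‖y η‖ := by
      rw [norm_smul, norm_inv, RCLike.norm_ofReal, abs_of_pos ht', inv_mul_le_iff₀ ht', h η,
        norm_neg]
      exact norm_flow_apply_sub_le (re_inner_modeOp_nonneg hC η) t.2 (x η)
    refine (norm_sub_le _ _).trans ?_
    rw [two_mul]
    exact add_le_add_left hb _
  · intro h η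
    refine tendsto_nhds_unique ?_ (hslope η)
    exact ((lp.evalCLM 𝕜 (fun _ : E => H) 2 η).continuous.tendsto y).comp h

open scoped Classical in
/-- Any semigroup generated by `-C_E` acts on a single mode as `exp(-t C_η)`: for fixed `t`, the
curve `s ↦ T(s) exp(-(t - s) C_η) v` has vanishing right derivative on `[0, t)`. -/
lemma C0Semigroup.HasGenerator.op_single {T : C0Semigroup 𝕜 (ModalSpace H E)}
    (hT : T.HasGenerator (-modalOp C E)) (η : E) (t : ℝ≥0) (v : H) :
    T.op t (lp.single 2 η v) = lp.single 2 η (flow (modeOp C (η : ℝ)) t v) := by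
  let : InnerProductSpace ℝ (ModalSpace H E) := InnerProductSpace.rclikeToReal 𝕜 _
  set A : H →L[𝕜] H := modeOp C (η : ℝ) with hA
  set J : H →L[𝕜] ModalSpace H E := lp.singleContinuousLinearMap 𝕜 (fun _ : E => H) 2 η with hJ
  have hgen : ∀ z : H, Tendsto (fun h : ℝ≥0 => (((h : ℝ) : 𝕜))⁻¹ • (T.op h (J z) - J z))
      (𝓝[>] 0) (𝓝 (-(J (A z)))) := by
    intro z
    refine (hT _ _).mp (mem_graph_neg_modalOp.mpr fun ξ => ?_)
    rcases eq_or_ne ξ η with rfl | hξ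
    · simp [hJ, hA]
    · simp [hJ, Pi.single_eq_of_ne hξ]
  set g : ℝ → ModalSpace H E := fun s => T.op s.toNNReal (J (flow A (t - s) v)) with hg
  have hcont : Continuous g := by
    refine continuous_iff_continuousAt.mpr fun s => T.tendsto_op_apply ?_ ?_
    · exact continuous_real_toNNReal.tendsto s
    · exact (J.continuous.comp ((continuous_flow_apply A v).comp
        (continuous_const.sub continuous_id))).tendsto s
  have hder : ∀ s ∈ Set.Ico (0 : ℝ) t, HasDerivWithinAt g 0 (Set.Ici s) s := by
    intro s hs
    rw [← hasDerivWithinAt_Ioi_iff_Ici, hasDerivWithinAt_iff_tendsto_slope' (by simp)]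
    set z : H := flow A (t - s) v with hz
    -- the increments of `g` over a time step `h`, split into those of state and semigroup
    have hlim : Tendsto (fun h : ℝ≥0 => T.op s.toNNReal
        (T.op h (J ((((h : ℝ) : 𝕜))⁻¹ • (flow A (t - s - h) v - z)))
          + (((h : ℝ) : 𝕜))⁻¹ • (T.op h (J z) - J z))) (𝓝[>] 0) (𝓝 0) := by
      have h1 : Tendsto (fun h : ℝ≥0 => T.op h (J ((((h : ℝ) : 𝕜))⁻¹ • (flow A (t - s - h) v - z))))
          (𝓝[>] 0) (𝓝 (T.op 0 (J (A z)))) := by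
        refine T.tendsto_op_apply (tendsto_id.mono_left nhdsWithin_le_nhds) ?_
        exact (J.continuous.tendsto _).comp
          ((tendsto_flow_slope_reverse A v (t - s)).comp tendsto_coe_nhdsGT_zero)
      have h2 := h1.add (hgen z)
      rw [T.op_zero, one_apply_eq_self, add_neg_cancel] at h2
      have h3 := ((T.op s.toNNReal).continuous.tendsto 0).comp h2
      rwa [map_zero] at h3
    have hsub : Tendsto (fun r : ℝ => (r - s).toNNReal) (𝓝[>] s) (𝓝[>] 0) := by
      refine tendsto_nhdsWithin_iff.mpr ⟨?_, ?_⟩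
      · have : Tendsto (fun r : ℝ => (r - s).toNNReal) (𝓝 s) (𝓝 (s - s).toNNReal) :=
          (continuous_real_toNNReal.comp (continuous_id.sub continuous_const)).tendsto s
        rw [sub_self, Real.toNNReal_zero] at this
        exact this.mono_left nhdsWithin_le_nhds
      · filter_upwards [self_mem_nhdsWithin] with r hr
        exact Real.toNNReal_pos.mpr (sub_pos.mpr hr)
    refine (hlim.comp hsub).congr' ?_
    filter_upwards [self_mem_nhdsWithin] with r hr
    have hrs : 0 ≤ r - s := (sub_pos.mpr hr).le
    have hr' : r.toNNReal = s.toNNReal + (r - s).toNNReal := by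
      rw [← Real.toNNReal_add hs.1 hrs, add_sub_cancel]
    rw [Function.comp_apply, slope_def_module, hg]
    simp only
    rw [hr', T.op_add, mul_apply_eq_comp, ← map_sub, RCLike.real_smul_eq_coe_smul (K := 𝕜),
      ← map_smul, Real.coe_toNNReal _ hrs, RCLike.ofReal_inv, map_smul J, map_smul, ← smul_add,
      map_sub J, map_sub, sub_add_sub_cancel, sub_sub, add_sub_cancel]
  have hconst := constant_of_has_deriv_right_zero hcont.continuousOn hder t ⟨t.2, le_rfl⟩
  simp only [hg, Real.toNNReal_coe, sub_self, flow_zero, one_apply_eq_self, Real.toNNReal_zero,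
    T.op_zero, sub_zero] at hconst
  exact hconst

lemma C0Semigroup.HasGenerator.eq_modalSemigroup {T : C0Semigroup 𝕜 (ModalSpace H E)}
    (hC : IsAccretive C) (hT : T.HasGenerator (-modalOp C E)) : T = modalSemigroup hC E := by
  classical
  refine C0Semigroup.eq_of_op_eq fun t => lp.ext_continuousLinearMap (by simp) fun η => ?_
  ext1 v
  exact (hT.op_single η t v).trans ((hasGenerator_modalSemigroup hC E).op_single η t v).symm

end ModalSemigroup

end

/-! ### The Lyapunov operator and the norm estimates -/

section

variable {𝕜 : Type*} [RCLike 𝕜] {H : Type*} [NormedAddCommGroup H] [InnerProductSpace 𝕜 H]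
  {E : Set ℝ} {m : ℕ}

lemma hasSum_re_inner (x y : ModalSpace H E) :
    HasSum (fun η : E => RCLike.re ⟪x η, y η⟫_𝕜) (RCLike.re ⟪x, y⟫_𝕜) :=
  (lp.hasSum_inner (𝕜 := 𝕜) x y).mapL (RCLike.reCLM (K := 𝕜))

lemma norm_sq_op_le {X : Type*} [NormedAddCommGroup X] [NormedSpace 𝕜 X] [Nontrivial X]
    (T : X →L[𝕜] X) {K : ℝ} (h : ∀ x, ‖T x‖ ^ 2 ≤ K * ‖x‖ ^ 2) : ‖T‖ ^ 2 ≤ K := by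
  have hK : 0 ≤ K := by
    obtain ⟨x, hx⟩ := exists_ne (0 : X)
    have h1 : 0 ≤ K * ‖x‖ ^ 2 := (sq_nonneg _).trans (h x)
    exact nonneg_of_mul_nonneg_left h1 (by positivity)
  refine (Real.le_sqrt (norm_nonneg _) hK).mp (T.opNorm_le_bound (Real.sqrt_nonneg K) fun x => ?_)
  rw [← Real.sqrt_sq (norm_nonneg x), ← Real.sqrt_mul hK]
  exact Real.le_sqrt_of_sq_le (h x)

lemma nontrivial_modalSpace [Nontrivial H] (hne : E.Nonempty) : Nontrivial (ModalSpace H E) := by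
  classical
  obtain ⟨η, hη⟩ := hne
  obtain ⟨v, hv⟩ := exists_ne (0 : H)
  refine ⟨lp.single 2 (⟨η, hη⟩ : E) v, 0, fun h => hv ?_⟩
  have := congrArg (fun x : ModalSpace H E => x ⟨η, hη⟩) h
  simpa using this

variable [CompleteSpace H] {C : H →L[𝕜] H}

lemma one_le_abs_of_subset (hE : E ⊆ (Set.Ioo (-1 : ℝ) 1)ᶜ) (η : E) : 1 ≤ |(η : ℝ)| := by
  by_contra! h
  exact hE η.2 (abs_lt.mp h)

/-- The operator `P_E`, acting on the mode `η` as `∑_{j ≤ m} η^{-2j} (C_η*)^j C_η^j`. -/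
def lyapunovOp (C : H →L[𝕜] H) (m : ℕ) (hE : E ⊆ (Set.Ioo (-1 : ℝ) 1)ᶜ) :
    ModalSpace H E →L[𝕜] ModalSpace H E :=
  diagonal (fun η : E => lyapunovMode C m η)
    (∑ j ∈ Finset.range (m + 1), ((1 + (‖skewPart C‖ + ‖hermPart C‖)) ^ j) ^ 2)
    fun η x => (lyapunovMode C m η).le_of_opNorm_le
      (norm_lyapunovMode_le C m (one_le_abs_of_subset hE η)) x

@[simp]
lemma lyapunovOp_apply (C : H →L[𝕜] H) (m : ℕ) (hE : E ⊆ (Set.Ioo (-1 : ℝ) 1)ᶜ)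
    (x : ModalSpace H E) (η : E) : lyapunovOp C m hE x η = lyapunovMode C m (η : ℝ) (x η) :=
  rfl

lemma isSelfAdjoint_lyapunovOp (C : H →L[𝕜] H) (m : ℕ) (hE : E ⊆ (Set.Ioo (-1 : ℝ) 1)ᶜ) :
    IsSelfAdjoint (lyapunovOp C m hE) := by
  rw [ContinuousLinearMap.isSelfAdjoint_iff_isSymmetric]
  intro x y
  refine (lp.inner_eq_tsum _ _).trans (Eq.trans ?_ (lp.inner_eq_tsum _ _).symm)
  exact tsum_congr fun η => ContinuousLinearMap.isSelfAdjoint_iff_isSymmetric.mp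
    (isSelfAdjoint_lyapunovMode C m (η : ℝ)) (x η) (y η)

lemma norm_sq_le_re_inner_lyapunovOp (C : H →L[𝕜] H) (m : ℕ) (hE : E ⊆ (Set.Ioo (-1 : ℝ) 1)ᶜ)
    (x : ModalSpace H E) : ‖x‖ ^ 2 ≤ RCLike.re ⟪lyapunovOp C m hE x, x⟫_𝕜 :=
  hasSum_le (fun η : E => norm_sq_le_re_inner_lyapunovMode C m (η : ℝ) (x η)) (hasSum_norm_sq x)
    (hasSum_re_inner (𝕜 := 𝕜) (lyapunovOp C m hE x) x)

lemma one_le_lyapunovOp (C : H →L[𝕜] H) (m : ℕ) (hE : E ⊆ (Set.Ioo (-1 : ℝ) 1)ᶜ) :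
    1 ≤ lyapunovOp C m hE := by
  rw [ContinuousLinearMap.le_def]
  refine (ContinuousLinearMap.isPositive_def').mpr ⟨?_, fun x => ?_⟩
  · exact (isSelfAdjoint_lyapunovOp C m hE).sub (IsSelfAdjoint.one _)
  · have h := norm_sq_le_re_inner_lyapunovOp C m hE x
    rw [ContinuousLinearMap.reApplyInnerSelf_apply, sub_apply, inner_sub_left, map_sub,
      one_apply_eq_self, inner_self_eq_norm_sq]
    exact sub_nonneg.mpr h

/-- The Lyapunov inequality for `P_E`. -/
lemma exists_lyapunov_inequality (hC : IsAccretive C) (hm : HypocoercivityBound C m)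
    (hE : E ⊆ (Set.Ioo (-1 : ℝ) 1)ᶜ) :
    ∃ σ : ℝ, 0 < σ ∧ ∀ x : (modalOp C E).domain,
      RCLike.re (⟪-(modalOp C E x), lyapunovOp C m hE (x : ModalSpace H E)⟫_𝕜 +
        ⟪lyapunovOp C m hE (x : ModalSpace H E), -(modalOp C E x)⟫_𝕜)
        ≤ -σ * ‖(x : ModalSpace H E)‖ ^ 2 := by
  obtain ⟨κ, hκ, hco⟩ := hm.exists_uniform hC
  refine ⟨2 * κ, by positivity, fun x => ?_⟩
  have h : κ * ‖(x : ModalSpace H E)‖ ^ 2 ≤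
      RCLike.re ⟪modalOp C E x, lyapunovOp C m hE (x : ModalSpace H E)⟫_𝕜 := by
    refine hasSum_le (fun η => ?_) ((hasSum_norm_sq (x : ModalSpace H E)).mul_left κ)
      (hasSum_re_inner (𝕜 := 𝕜) _ _)
    exact (hco η (one_le_abs_of_subset hE η) ((x : ModalSpace H E) η)).trans_eq
      (re_inner_modeOp_lyapunovMode C m (η : ℝ) ((x : ModalSpace H E) η)).symm
  rw [map_add, inner_neg_left, inner_neg_right, map_neg, map_neg,
    inner_re_symm (lyapunovOp C m hE (x : ModalSpace H E))]
  linarith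

/-- Exponential stability, from a decay factor below `1` at one positive time that is common to all
modes. -/
lemma exponentiallyStable_modalSemigroup (hC : IsAccretive C) (hm : HypocoercivityBound C m)
    (hE : E ⊆ (Set.Ioo (-1 : ℝ) 1)ᶜ) : (modalSemigroup hC E).ExponentiallyStable := by
  obtain ⟨c, τ, hc, hτ, hdec⟩ := exists_modeOp_decay hC hm
  set s : ℝ := c * τ ^ (2 * m + 1) with hs
  have hs0 : 0 < s := by positivity
  refine ⟨Real.exp (s / 2), s / (2 * τ), Real.exp_pos _, by positivity, fun t => ?_⟩
  refine ContinuousLinearMap.opNorm_le_bound _ (by positivity) fun x => ?_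
  refine (sq_le_sq₀ (norm_nonneg _) (by positivity)).mp ?_
  rw [mul_pow]
  refine norm_sq_le_of_forall_norm_sq_le fun η => ?_
  have hstep : ∀ y : H, ‖flow (modeOp C (η : ℝ)) τ y‖ ^ 2 ≤ Real.exp (-s) * ‖y‖ ^ 2 := by
    intro y
    refine (hdec η (one_le_abs_of_subset hE η) y τ hτ.le le_rfl).trans ?_
    gcongr
    have := Real.add_one_le_exp (-s)
    linarith
  refine (norm_sq_flow_le_exp_floor (re_inner_modeOp_nonneg hC η) hτ hstep t.2 (x η)).trans ?_
  gcongr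
  rw [← Real.exp_add, ← Real.exp_nat_mul, Real.exp_le_exp]
  have hfl := mul_le_mul_of_nonneg_right (Nat.lt_floor_add_one ((t : ℝ) / τ)).le hs0.le
  have e : ((2 : ℕ) : ℝ) * (s / 2 + -(s / (2 * τ) * (t : ℝ))) = s - (t : ℝ) / τ * s := by
    push_cast
    field_simp
    ring
  rw [e]
  rw [NNReal.val_eq_coe]
  linarith

/-- Two-sided short-time estimate for the norm of `T_E(t)`. -/
lemma exists_norm_sq_modalSemigroup_bounds [Nontrivial H] (hC : IsHypocoerciveWithIndex C m)
    (hE : E ⊆ (Set.Ioo (-1 : ℝ) 1)ᶜ) (hne : E.Nonempty) :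
    ∃ c₁ c₂ τ : ℝ, 0 < c₁ ∧ 0 < c₂ ∧ 0 < τ ∧ ∀ t : ℝ≥0, (t : ℝ) ≤ τ →
      1 - c₁ * (t : ℝ) ^ (2 * m + 1) ≤ ‖(modalSemigroup hC.accretive E).op t‖ ^ 2 ∧
      ‖(modalSemigroup hC.accretive E).op t‖ ^ 2 ≤ 1 - c₂ * (t : ℝ) ^ (2 * m + 1) := by
  classical
  have := nontrivial_modalSpace (H := H) hne
  obtain ⟨η₀, hη₀⟩ := hne
  set η : E := ⟨η₀, hη₀⟩
  have hη := one_le_abs_of_subset hE η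
  obtain ⟨c₂, τ, hc₂, hτ, hdec⟩ := exists_modeOp_decay hC.accretive hC.isLeast.1
  obtain ⟨c₁, hc₁, hlow⟩ := exists_short_time_lower_bound hC.accretive.isPositive m
    (re_inner_modeOp C (η : ℝ)) (fun ε hε => hC.exists_small_dissipation hη hε)
  refine ⟨c₁, c₂, min 1 τ, hc₁, hc₂, by positivity, fun t ht => ⟨?_, ?_⟩⟩
  · refine hlow t _ t.2 (ht.trans (min_le_left _ _)) fun x => ?_
    have hsingle : ‖flow (modeOp C (η : ℝ)) t x‖
        ≤ ‖(modalSemigroup hC.accretive E).op t‖ * ‖x‖ := by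
      have h := ((modalSemigroup hC.accretive E).op t).le_opNorm (lp.single 2 η x)
      rw [(hasGenerator_modalSemigroup hC.accretive E).op_single η t x,
        lp.norm_single (by norm_num), lp.norm_single (by norm_num)] at h
      exact h
    rw [← mul_pow]
    exact pow_le_pow_left₀ (norm_nonneg _) hsingle 2
  · refine norm_sq_op_le _ fun x => norm_sq_le_of_forall_norm_sq_le fun ξ => ?_
    exact hdec ξ (one_le_abs_of_subset hE ξ) (x ξ) t t.2 (ht.trans (min_le_right _ _))

end

end Hypo

end

theorem theorem1 {𝕜 : Type*} [RCLike 𝕜] {H : Type*} [NormedAddCommGroup H]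
    [InnerProductSpace 𝕜 H] [CompleteSpace H] [Nontrivial H]
    (C : H →L[𝕜] H) (m : ℕ) (hC : Hypo.IsHypocoerciveWithIndex C m)
    (E : Set ℝ) (hE : E ⊆ (Set.Ioo (-1 : ℝ) 1)ᶜ) (hne : E.Nonempty) (hcount : E.Countable) :
    -- `-C_E` generates exactly one strongly continuous semigroup
    (∃! T : Hypo.C0Semigroup 𝕜 (Hypo.ModalSpace H E), T.HasGenerator (-Hypo.modalOp C E)) ∧
    -- (a), the operator `P_E`
    (∃ P : Hypo.ModalSpace H E →L[𝕜] Hypo.ModalSpace H E,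
      (∀ (x : Hypo.ModalSpace H E) (η : E), P x η = Hypo.lyapunovMode C m (η : ℝ) (x η)) ∧
      IsSelfAdjoint P ∧ 1 ≤ P ∧
      ∃ σ : ℝ, 0 < σ ∧ ∀ x : (Hypo.modalOp C E).domain,
        RCLike.re (⟪-(Hypo.modalOp C E x), P (x : Hypo.ModalSpace H E)⟫_𝕜 +
          ⟪P (x : Hypo.ModalSpace H E), -(Hypo.modalOp C E x)⟫_𝕜)
          ≤ -σ * ‖(x : Hypo.ModalSpace H E)‖ ^ 2) ∧
    ∀ T : Hypo.C0Semigroup 𝕜 (Hypo.ModalSpace H E), T.HasGenerator (-Hypo.modalOp C E) →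
      -- (a), exponential stability
      T.ExponentiallyStable ∧
      -- (b), short-time asymptotics
      ∃ c₁ c₂ τ : ℝ, 0 < c₁ ∧ 0 < c₂ ∧ 0 < τ ∧ ∀ t : ℝ≥0, (t : ℝ) ≤ τ →
        1 - c₁ * (t : ℝ) ^ (2 * m + 1) ≤ ‖T.op t‖ ^ 2 ∧
        ‖T.op t‖ ^ 2 ≤ 1 - c₂ * (t : ℝ) ^ (2 * m + 1) := by
  refine ⟨⟨Hypo.modalSemigroup hC.accretive E, Hypo.hasGenerator_modalSemigroup hC.accretive E,
    fun T hT => hT.eq_modalSemigroup hC.accretive⟩, ⟨Hypo.lyapunovOp C m hE,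
    Hypo.lyapunovOp_apply C m hE, Hypo.isSelfAdjoint_lyapunovOp C m hE,
    Hypo.one_le_lyapunovOp C m hE,
    Hypo.exists_lyapunov_inequality hC.accretive hC.isLeast.1 hE⟩, fun T hT => ?_⟩
  rw [hT.eq_modalSemigroup hC.accretive]
  exact ⟨Hypo.exponentiallyStable_modalSemigroup hC.accretive hC.isLeast.1 hE,
    Hypo.exists_norm_sq_modalSemigroup_bounds hC hE hne⟩
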